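/- Consider $N\ge 1$ agents. Agent $i$ has state $x_i(k)\in\mathbb{R}^{n_i}$ ($n_i\ge1$), dynamics $x_i(k+1)=A_ix_i(k)+B_iu_i(k)+w_i(k)$ with $w_i(k)\sim\mathcal N(0,W_i)$, $W_i\succ0$, and output $y_i(k)=C_ix_i(k)$. Let $A,B,C,W$ be the block-diagonal matrices built from $A_i,B_i,C_i,W_i$, let $n=\sum_i n_i$, and let $Q=Q^T\succ0$, $R=R^T\succ0$ be network-level weights. Assume that $(A,B)$ is controllable, that $Q=F^TF$ for some $F$ with $(A,F)$ observable, and that $C$ is diagonal and positive definite. Let $\bar x\in\mathbb{R}^n$ be the limit of the network reference trajectory. Agent $i$ has an adjacency parameter $b_i>0$ and privacy parameters $\epsilon_i>0$, $\delta_i\in[10^{-5},10^{-1}]$. Let $\Delta_{\ell_2}y_i=\sup\|C_ix-C_ix'\|_{\ell_2}$ over all trajectories $x,x'$ with $\|x-x'\|_{\ell_2}\le b_i$, let $K_{\delta}=\mathcal Q^{-1}(\delta)$ with $\mathcal Q(y)=\frac1{\sqrt{2\pi}}\int_y^\infty e^{-z^2/2}dz$, and set $$\sigma_i=\bar\sigma_i=\frac{\Delta_{\ell_2}y_i}{2\epsilon_i}\Big(K_{\delta_i}+\sqrt{K_{\delta_i}^2+2\epsilon_i}\Big),\quad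 V=\mathrm{diag}(\sigma_1^2I_{n_1},\dots,\sigma_N^2I_{n_N}),\quad \overline W=\mathrm{diag}(\bar\sigma_1^2I_{n_1},\dots,\bar\sigma_N^2I_{n_N}).$$ Let $K$ and $\Sigma$ be the positive semidefinite solutions of the Riccati equations $$K=A^TKA-A^TKB(R+B^TKB)^{-1}B^TKA+Q,\qquad \Sigma=A\Sigma A^T-A\Sigma C^T(C\Sigma C^T+V)^{-1}C\Sigma A^T+W,$$ and put $\overline\Sigma=\Sigma-\Sigma C^T(C\Sigma C^T+V)^{-1}C\Sigma$, $L=-(R+B^TKB)^{-1}B^TKA$, $M=-(R+B^TKB)^{-1}B^T$, $H=M[I-(A+BL)^T]^{-1}$. For $r\in\mathbb{R}^n$ let $g(r)$ be the solution of $g=A^T[I-KB(R+B^TKB)^{-1}B^T]g-Qr$. In the private LQG algorithm the cloud receives $\tilde x=\bar x+\bar w$ with $\bar w\sim\mathcal N(0,\overline W)$ and $\tilde y(k)=Cx(k)+v(k)$ with $v(k)\sim\mathcal N(0,V)$, applies $u(k)=L\hat x(k)+Mg(\tilde x)$, and computes $\hat x(0)=\mathbb E[x(0)]$, $\hat x(k+1)=\hat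 x^-(k+1)+\overline\Sigma C^TV^{-1}(\tilde y(k+1)-C\hat x^-(k+1))$ with $\hat x^-(k+1)=A\hat x(k)+Bu(k)$. The vector $x(0)$ has finite second moments, the noises $w_i(k)$ and $w_j(k)$ are uncorrelated for $i\ne j$, and the random vectors $x(0)$, $\bar w$, $w(k)$ and $v(k)$ ($k\ge0$) are pairwise uncorrelated. The private cost is $$\tilde J(x,u)=\lim_{K_f\to\infty}\frac1{K_f}\,\mathbb E\Big\{\sum_{k=1}^{K_f}(x(k)-\tilde x)^TQ(x(k)-\tilde x)+u(k)^TRu(k)\Big\}.$$ For $1\le j\le n$ write $C_j$ for the $j$-th diagonal entry of $C$ and $\sigma_{(j)}$ for the noise level of the agent that owns coordinate $j$, and let $l$ be an index that minimizes $C_j^2/\sigma_{(j)}^2$. Let $\lambda_1(K)$ be the largest eigenvalue of $K$ and $g=g(\bar x)$. **Theorem.** Let $\alpha\in\mathbb{R}$ be such that $\alpha-\lambda_1(K)\,\mathrm{tr}W-\bar x^TQ\bar x+g^TB(R+B^TKB)^{-1}B^Tg>0$. If every agent $i$ has $$\epsilon_i\ge\frac18\left(\frac{1+\sqrt{36\,\eta_{5}+1}}{\eta_{5}}\right)^2,\qquad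 \eta_5:=\left[\frac{\alpha-\lambda_1(K)\,\mathrm{tr}W-\bar x^TQ\bar x+g^TB(R+B^TKB)^{-1}B^Tg}{(\Delta_{\ell_2}y_i)^2\Big(\lambda_1(K)\frac{\mathrm{tr}(A^TA)}{C_l^2}+\mathrm{tr}(H^TRH)+\mathrm{tr}(Q)\Big)}\right]^{1/2}$$ (so that $\eta_5$ depends on $i$ through $\Delta_{\ell_2}y_i$), then the limit $\tilde J(x,u)$ exists, all expectations in it being finite, and $\tilde J(x,u)\le\alpha$. -/

import Mathlib

open MeasureTheory ProbabilityTheory Filter Topology Matrix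
open scoped ENNReal

noncomputable section

namespace PrivateLQG

/-! ### Gaussian tail function, sensitivity, Gaussian mechanism -/

/-- The Gaussian tail `𝒬(y) = (1/√(2π)) ∫_y^∞ exp(-z²/2) dz`. -/
def gaussianTail (y : ℝ) : ℝ :=
  (1 / √(2 * Real.pi)) * ∫ z in Set.Ioi y, Real.exp (-z ^ 2 / 2)

/-- `K_δ = 𝒬⁻¹(δ)`. -/
def gaussianTailInv (δ : ℝ) : ℝ := Function.invFun gaussianTail δ

/-- The `ℓ₂` norm of a trajectory in `ℝ^d`, with value `∞` when it is not square summable. -/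
def trajNorm {d : ℕ} (z : ℕ → Fin d → ℝ) : ℝ≥0∞ :=
  (∑' k, ∑ a, ENNReal.ofReal (z k a ^ 2)) ^ (1 / 2 : ℝ)

/-- The `ℓ₂` sensitivity of the output `y(k) = C x(k)` for the adjacency relation
`‖x - x'‖_{ℓ₂} ≤ b` on state trajectories (every trajectory has finite truncations,
so trajectories are arbitrary sequences). -/
def outputSensitivity {q d : ℕ} (C : Matrix (Fin q) (Fin d) ℝ) (b : ℝ) : ℝ≥0∞ :=
  ⨆ (x : ℕ → Fin d → ℝ) (x' : ℕ → Fin d → ℝ)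
    (_ : trajNorm (fun k => x k - x' k) ≤ ENNReal.ofReal b),
    trajNorm (fun k => C *ᵥ x k - C *ᵥ x' k)

/-- Noise standard deviation of the Gaussian mechanism with sensitivity `Δ`:
`(Δ / (2ε)) (K_δ + √(K_δ² + 2ε))`. -/
def gaussianMechanismStd (Δ ε δ : ℝ) : ℝ :=
  Δ / (2 * ε) * (gaussianTailInv δ + √(gaussianTailInv δ ^ 2 + 2 * ε))

/-! ### Linear systems -/

/-- The columns of `B, AB, …, A^(n-1) B` span `ℝⁿ`. -/
def IsControllable {X U : Type*} [Fintype X] [DecidableEq X]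
    (A : Matrix X X ℝ) (B : Matrix X U ℝ) : Prop :=
  Submodule.span ℝ {z : X → ℝ | ∃ j < Fintype.card X, ∃ c : U, z = fun a => (A ^ j * B) a c} = ⊤

/-- `F x = 0, F A x = 0, …, F A^(n-1) x = 0` only for `x = 0`. -/
def IsObservable {X Y : Type*} [Fintype X] [DecidableEq X]
    (A : Matrix X X ℝ) (F : Matrix Y X ℝ) : Prop :=
  ∀ x : X → ℝ, (∀ j < Fintype.card X, (F * A ^ j) *ᵥ x = 0) → x = 0

/-- The largest eigenvalue of a symmetric real matrix. -/
def lambdaMax {X : Type*} [Fintype X] [DecidableEq X] (M : Matrix X X ℝ) : ℝ :=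
  sSup (spectrum ℝ M)

/-! ### The multi-agent network -/

/-- Data of a network of `N` agents. Agent `i` has state dimension `n i`, input dimension `m i`,
dynamics `x_i(k+1) = A_i x_i(k) + B_i u_i(k) + w_i(k)` with `w_i(k) ∼ 𝒩(0, W_i)`, output
`y_i(k) = C_i x_i(k)`, adjacency parameter `b i` and privacy parameters `ε i`, `δ i`.
`Q`, `R` are the network-level cost weights, `xbar` is the limit of the reference trajectory. -/
structure Network (N : ℕ) where
  n : Fin N → ℕ
  m : Fin N → ℕ
  A : ∀ i, Matrix (Fin (n i)) (Fin (n i)) ℝ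
  B : ∀ i, Matrix (Fin (n i)) (Fin (m i)) ℝ
  C : ∀ i, Matrix (Fin (n i)) (Fin (n i)) ℝ
  W : ∀ i, Matrix (Fin (n i)) (Fin (n i)) ℝ
  Q : Matrix (Σ i, Fin (n i)) (Σ i, Fin (n i)) ℝ
  R : Matrix (Σ i, Fin (m i)) (Σ i, Fin (m i)) ℝ
  xbar : (Σ i, Fin (n i)) → ℝ
  b : Fin N → ℝ
  ε : Fin N → ℝ
  δ : Fin N → ℝ

namespace Network

variable {N : ℕ} (net : Network N)

/-- Coordinates of the network state. -/
abbrev X : Type := Σ i, Fin (net.n i)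

/-- Coordinates of the network input. -/
abbrev U : Type := Σ i, Fin (net.m i)

/-- `A = diag(A_1, …, A_N)`. -/
def bigA : Matrix net.X net.X ℝ := blockDiagonal' net.A

/-- `B = diag(B_1, …, B_N)`. -/
def bigB : Matrix net.X net.U ℝ := blockDiagonal' net.B

/-- `C = diag(C_1, …, C_N)`. -/
def bigC : Matrix net.X net.X ℝ := blockDiagonal' net.C

/-- `W = diag(W_1, …, W_N)`. -/
def bigW : Matrix net.X net.X ℝ := blockDiagonal' net.W

/-- The sensitivity `Δ_{ℓ₂} y_i` of agent `i`'s output (a finite number). -/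
def sens (i : Fin N) : ℝ := (outputSensitivity (net.C i) (net.b i)).toReal

/-- `σ_i = (Δ_{ℓ₂} y_i / (2ε_i)) (K_{δ_i} + √(K_{δ_i}² + 2ε_i))`. -/
def σ (i : Fin N) : ℝ := gaussianMechanismStd (net.sens i) (net.ε i) (net.δ i)

/-- The noise level for the reference limits, `σ̄_i = σ_i`. -/
def σbar (i : Fin N) : ℝ := net.σ i

/-- `V = diag(σ_1² I, …, σ_N² I)`. -/
def V : Matrix net.X net.X ℝ := diagonal fun p => net.σ p.1 ^ 2

/-- `W̄ = diag(σ̄_1² I, …, σ̄_N² I)`. -/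
def Wbar : Matrix net.X net.X ℝ := diagonal fun p => net.σbar p.1 ^ 2

/-- Standing assumptions on the dynamics, the cost, the outputs and the privacy parameters. -/
structure Standing : Prop where
  agents_pos : 0 < N
  dim_pos : ∀ i, 0 < net.n i
  W_posDef : ∀ i, (net.W i).PosDef
  Q_posDef : net.Q.PosDef
  R_posDef : net.R.PosDef
  controllable : IsControllable net.bigA net.bigB
  observable : ∃ (p : ℕ) (F : Matrix (Fin p) net.X ℝ), net.Q = Fᵀ * F ∧ IsObservable net.bigA F
  C_diag : net.bigC.IsDiag
  C_posDef : net.bigC.PosDef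
  b_pos : ∀ i, 0 < net.b i
  ε_pos : ∀ i, 0 < net.ε i

/-! ### Controller and filter -/

/-- `K` is a positive semidefinite solution of the control Riccati equation. -/
def IsControlRiccati (K : Matrix net.X net.X ℝ) : Prop :=
  K.PosSemidef ∧
    K = net.bigAᵀ * K * net.bigA
      - net.bigAᵀ * K * net.bigB * (net.R + net.bigBᵀ * K * net.bigB)⁻¹
        * net.bigBᵀ * K * net.bigA + net.Q

/-- `S` (the a priori error covariance `Σ`) is a positive semidefinite solution of the filter
Riccati equation. -/
def IsFilterRiccati (S : Matrix net.X net.X ℝ) : Prop :=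
  S.PosSemidef ∧
    S = net.bigA * S * net.bigAᵀ
      - net.bigA * S * net.bigCᵀ * (net.bigC * S * net.bigCᵀ + net.V)⁻¹
        * net.bigC * S * net.bigAᵀ + net.bigW

/-- The a posteriori error covariance `Σ̄ = Σ - Σ Cᵀ (C Σ Cᵀ + V)⁻¹ C Σ`. -/
def postCov (S : Matrix net.X net.X ℝ) : Matrix net.X net.X ℝ :=
  S - S * net.bigCᵀ * (net.bigC * S * net.bigCᵀ + net.V)⁻¹ * net.bigC * S

/-- `L = -(R + Bᵀ K B)⁻¹ Bᵀ K A`. -/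
def L (K : Matrix net.X net.X ℝ) : Matrix net.U net.X ℝ :=
  -((net.R + net.bigBᵀ * K * net.bigB)⁻¹ * net.bigBᵀ * K * net.bigA)

/-- `M = -(R + Bᵀ K B)⁻¹ Bᵀ`. -/
def M (K : Matrix net.X net.X ℝ) : Matrix net.U net.X ℝ :=
  -((net.R + net.bigBᵀ * K * net.bigB)⁻¹ * net.bigBᵀ)

/-- `H = M [I - (A + B L)ᵀ]⁻¹`. -/
def H (K : Matrix net.X net.X ℝ) : Matrix net.U net.X ℝ :=
  net.M K * (1 - (net.bigA + net.bigB * net.L K)ᵀ)⁻¹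

/-- The solution `g` of `g = Aᵀ [I - K B (R + Bᵀ K B)⁻¹ Bᵀ] g - Q r` for the reference `r`. -/
def g (K : Matrix net.X net.X ℝ) (r : net.X → ℝ) : net.X → ℝ :=
  (1 - net.bigAᵀ *
    (1 - K * net.bigB * (net.R + net.bigBᵀ * K * net.bigB)⁻¹ * net.bigBᵀ))⁻¹ *ᵥ (-(net.Q *ᵥ r))

/-! ### Noise -/

/-- The sources of randomness in the network, indexed by time where applicable. -/
inductive Source where
  | init
  | ref
  | proc (k : ℕ)
  | priv (k : ℕ)

/-- The primitive random vectors: the initial state `x(0)`, the reference noise `w̄`, the process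
noise `w(k)` and the privacy noise `v(k)`. -/
structure Noise (Ω : Type*) where
  x0 : Ω → net.X → ℝ
  wbar : Ω → net.X → ℝ
  w : ℕ → Ω → net.X → ℝ
  v : ℕ → Ω → net.X → ℝ

variable {net}

/-- The random vector attached to a source. -/
def Noise.signal {Ω : Type*} (ξ : net.Noise Ω) : Source → Ω → net.X → ℝ
  | .init => ξ.x0
  | .ref => ξ.wbar
  | .proc k => ξ.w k
  | .priv k => ξ.v k

/-- Probabilistic assumptions: `x(0)` has finite second moments, `w_i(k) ∼ 𝒩(0, W_i)` with distinct
agents uncorrelated, `v(k) ∼ 𝒩(0, V)`, `w̄ ∼ 𝒩(0, W̄)`, and distinct sources are uncorrelated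
(in particular, independent sources are allowed). -/
structure Noise.IsModel {Ω : Type*} [MeasurableSpace Ω] (ξ : net.Noise Ω) (μ : Measure Ω) :
    Prop where
  init_memLp : ∀ p, MemLp (fun ω => ξ.x0 ω p) 2 μ
  proc_law : ∀ k i, HasLaw (fun ω => WithLp.toLp 2 fun a : Fin (net.n i) => ξ.w k ω ⟨i, a⟩)
    (multivariateGaussian 0 (net.W i)) μ
  proc_uncorr : ∀ k, ∀ p q : net.X, p.1 ≠ q.1 →
    cov[fun ω => ξ.w k ω p, fun ω => ξ.w k ω q; μ] = 0
  priv_law : ∀ k, HasLaw (fun ω => WithLp.toLp 2 (ξ.v k ω)) (multivariateGaussian 0 net.V) μ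
  ref_law : HasLaw (fun ω => WithLp.toLp 2 (ξ.wbar ω)) (multivariateGaussian 0 net.Wbar) μ
  uncorr : ∀ s t : Source, s ≠ t → ∀ p q : net.X,
    cov[fun ω => ξ.signal s ω p, fun ω => ξ.signal t ω q; μ] = 0

variable (net)

/-! ### The private closed loop and its cost -/

section ClosedLoop

variable {Ω : Type*} [MeasurableSpace Ω] (μ : Measure Ω) (ξ : net.Noise Ω)
  (K S : Matrix net.X net.X ℝ)

/-- The privatized reference `x̃ = x̄ + w̄`. -/
def xtilde (ω : Ω) : net.X → ℝ := net.xbar + ξ.wbar ω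

/-- The control law `u = L x̂ + M g`, with `g` computed from `x̃`. -/
def control (ω : Ω) (xhat : net.X → ℝ) : net.U → ℝ :=
  net.L K *ᵥ xhat + net.M K *ᵥ net.g K (net.xtilde ξ ω)

/-- The pair `(x(k), x̂(k))` of true network state and cloud estimate. -/
def loop : ℕ → Ω → (net.X → ℝ) × (net.X → ℝ)
  | 0, ω => (ξ.x0 ω, fun p => ∫ ω', ξ.x0 ω' p ∂μ)
  | k + 1, ω =>
    let x := (loop k ω).1
    let xhat := (loop k ω).2
    let u := net.control ξ K ω xhat
    let xnext := net.bigA *ᵥ x + net.bigB *ᵥ u + ξ.w k ω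
    let xpred := net.bigA *ᵥ xhat + net.bigB *ᵥ u
    let ytilde := net.bigC *ᵥ xnext + ξ.v (k + 1) ω
    (xnext, xpred + (net.postCov S * net.bigCᵀ * net.V⁻¹) *ᵥ (ytilde - net.bigC *ᵥ xpred))

/-- The stage cost `(x(k) - x̃)ᵀ Q (x(k) - x̃) + u(k)ᵀ R u(k)`. -/
def stageCost (k : ℕ) (ω : Ω) : ℝ :=
  let e := (net.loop μ ξ K S k ω).1 - net.xtilde ξ ω
  let u := net.control ξ K ω (net.loop μ ξ K S k ω).2
  e ⬝ᵥ (net.Q *ᵥ e) + u ⬝ᵥ (net.R *ᵥ u)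

/-- `J` is the private cost `J̃(x,u)`: the stage costs are integrable, and
`(1/K_f) E[∑_{k=1}^{K_f} stage cost]` converges to `J` as `K_f → ∞`. -/
def IsPrivateCost (J : ℝ) : Prop :=
  (∀ k, Integrable (net.stageCost μ ξ K S k) μ) ∧
    Tendsto (fun Kf : ℕ =>
      (1 / (Kf : ℝ)) * ∫ ω, ∑ k ∈ Finset.Icc 1 Kf, net.stageCost μ ξ K S k ω ∂μ) atTop (𝓝 J)

end ClosedLoop

/-! ### The tuning rule -/

/-- `l` minimizes `C_jj² / σ_j²` over the coordinates `j` of the network, where `σ_j` is the noise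
level of the agent that owns the coordinate `j`. -/
def IsMinSignalToNoise (l : net.X) : Prop :=
  ∀ j : net.X, net.bigC l l ^ 2 / net.σ l.1 ^ 2 ≤ net.bigC j j ^ 2 / net.σ j.1 ^ 2

/-- `α - λ₁(K) tr W - x̄ᵀ Q x̄ + gᵀ B (R + Bᵀ K B)⁻¹ Bᵀ g`, with `g` for the reference `x̄`. -/
def costMargin (K : Matrix net.X net.X ℝ) (α : ℝ) : ℝ :=
  α - lambdaMax K * net.bigW.trace - net.xbar ⬝ᵥ (net.Q *ᵥ net.xbar)
    + net.g K net.xbar ⬝ᵥ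
      ((net.bigB * (net.R + net.bigBᵀ * K * net.bigB)⁻¹ * net.bigBᵀ) *ᵥ net.g K net.xbar)

/-- The constant `η₅` of agent `i`. -/
def eta5 (K : Matrix net.X net.X ℝ) (α : ℝ) (l : net.X) (i : Fin N) : ℝ :=
  √(net.costMargin K α /
    (net.sens i ^ 2 *
      (lambdaMax K * ((net.bigAᵀ * net.bigA).trace / net.bigC l l ^ 2)
        + ((net.H K)ᵀ * net.R * net.H K).trace + net.Q.trace)))

end Network

end PrivateLQG

end

/-! Write S = R + BᵀKB, let e(k) be the estimation error and g the feedforward vector g(x̃).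
Completing the square with the control Riccati equation (`tracking_bellman`) gives a pathwise
identity: the stage cost is a decrement of the value xᵀKx + 2g·x, plus process noise terms, plus a
term in x̃ alone, plus eᵀ(LᵀSL)e. Since g is random but constant in time, the value telescopes even
though the reference is random.

In expectation the noise terms leave tr(KW), since w(k) is orthogonal to everything that precedes
it; all maps are affine, so uncorrelated sources suffice (`loop_orthogonal`). The error covariance
obeys the affine recursion whose fixed point is Σ̄ and whose linear part is stable, hence it
converges to Σ̄ from any start (`errCov_tendsto`). The Riccati equations are also Lyapunov
equations; as Q and W are positive definite, they make A + BL and the error dynamics stable, so the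
expected value stays bounded (`exists_state_energy_le`) and a Cesàro argument yields J = tr(KW) +
E[x̃ᵀQx̃ − gᵀBS⁻¹Bᵀg] + tr(LᵀSL Σ̄).

For the bound, tr(KW) ≤ λ₁(K) tr W. The middle term is at most its value at x̄ plus tr(QW̄), the
fluctuation of g only lowering it. Finally LᵀSL = AᵀKA − (K − Q) with K ⪰ Q, and Σ̄ ⪯ (σ_l²/C_l²) I,
so the last term is at most σ_l² λ₁(K) tr(AᵀA)/C_l². The condition on ε_i is the solution of a
quadratic inequality which, with K_δ ≤ 9/2, gives σ_i ≤ Δ_i η₅ (`gaussianMechanismStd_le`); then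
σ_i² times the bracket in η₅ is at most the cost margin, and the bounds add up to α. -/

noncomputable section

namespace PrivateLQG

/-! ### Quadratic forms, Lyapunov equations and trace inequalities -/

section QuadraticForms

variable {ι κ : Type*}

lemma transpose_eq_of_posSemidef {M : Matrix ι ι ℝ} (hM : M.PosSemidef) : Mᵀ = M := by
  rw [← conjTranspose_eq_transpose_of_trivial]
  exact hM.isHermitian

variable [Fintype ι] [Fintype κ]

open scoped MatrixOrder in
lemma exists_eq_transpose_mul_self [DecidableEq ι] {M : Matrix ι ι ℝ} (hM : M.PosSemidef) :
    ∃ B : Matrix ι ι ℝ, M = Bᵀ * B := by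
  obtain ⟨B, hB⟩ := CStarAlgebra.nonneg_iff_eq_star_mul_self.mp hM.nonneg
  exact ⟨B, by rw [hB, star_eq_conjTranspose, conjTranspose_eq_transpose_of_trivial]⟩

lemma trace_mul_nonneg {P W : Matrix ι ι ℝ} (hP : P.PosSemidef) (hW : W.PosSemidef) :
    0 ≤ (P * W).trace := by
  classical
  obtain ⟨B, rfl⟩ := exists_eq_transpose_mul_self hW
  have h := (hP.mul_mul_conjTranspose_same B).trace_nonneg
  rwa [conjTranspose_eq_transpose_of_trivial, Matrix.mul_assoc, Matrix.trace_mul_comm, Matrix.mul_assoc] at h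

lemma mulVec_dotProduct_eq (A : Matrix κ ι ℝ) (x : ι → ℝ) (y : κ → ℝ) :
    (A *ᵥ x) ⬝ᵥ y = x ⬝ᵥ (Aᵀ *ᵥ y) := by
  rw [dotProduct_comm, dotProduct_mulVec, dotProduct_comm, mulVec_transpose]

lemma quad_comm {M : Matrix ι ι ℝ} (hM : Mᵀ = M) (x y : ι → ℝ) :
    x ⬝ᵥ (M *ᵥ y) = y ⬝ᵥ (M *ᵥ x) := by
  rw [← hM, ← mulVec_dotProduct_eq, hM, dotProduct_comm]

lemma exists_abs_quad_le (M : Matrix ι ι ℝ) :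
    ∃ c : ℝ, 0 ≤ c ∧ ∀ z : ι → ℝ, |z ⬝ᵥ (M *ᵥ z)| ≤ c * (z ⬝ᵥ z) := by
  -- Any constant will do; the entrywise ℓ¹ norm works because |z i * z j| ≤ z ⬝ᵥ z.
  refine ⟨∑ i, ∑ j, |M i j|, by positivity, fun z => ?_⟩
  have hz : ∀ i, z i ^ 2 ≤ z ⬝ᵥ z := fun i => by
    rw [sq]
    exact Finset.single_le_sum (f := fun i => z i * z i) (fun i _ => mul_self_nonneg _)
      (Finset.mem_univ i)
  have e : z ⬝ᵥ (M *ᵥ z) = ∑ i, ∑ j, z i * (M i j * z j) := by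
    simp only [dotProduct, mulVec, Finset.mul_sum]
  rw [e]
  simp only [Finset.sum_mul]
  refine (Finset.abs_sum_le_sum_abs _ _).trans (Finset.sum_le_sum fun i _ => ?_)
  refine (Finset.abs_sum_le_sum_abs _ _).trans ?_
  refine Finset.sum_le_sum fun j _ => ?_
  rw [mul_left_comm, abs_mul]
  refine mul_le_mul_of_nonneg_left ?_ (abs_nonneg _)
  have h1 := hz i
  have h2 := hz j
  rw [abs_le]
  constructor <;> nlinarith [sq_nonneg (z i + z j), sq_nonneg (z i - z j)]

/-- Factor Y = BᵀB with B invertible and apply the upper bound to (B⁻¹)ᵀB⁻¹ at the vector Bz. -/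
lemma exists_le_quad {Y : Matrix ι ι ℝ} (hY : Y.PosDef) :
    ∃ c : ℝ, 0 < c ∧ ∀ z : ι → ℝ, c * (z ⬝ᵥ z) ≤ z ⬝ᵥ (Y *ᵥ z) := by
  classical
  obtain ⟨B, hB⟩ := exists_eq_transpose_mul_self hY.posSemidef
  have hdet : IsUnit B.det := by
    have h := hY.det_pos.ne'
    rw [hB, det_mul] at h
    exact (right_ne_zero_of_mul h).isUnit
  obtain ⟨c, hc, hcz⟩ := exists_abs_quad_le ((B⁻¹)ᵀ * B⁻¹)
  refine ⟨(c + 1)⁻¹, by positivity, fun z => ?_⟩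
  have h := (le_abs_self _).trans (hcz (B *ᵥ z))
  have h1 : (B *ᵥ z) ⬝ᵥ (((B⁻¹)ᵀ * B⁻¹) *ᵥ (B *ᵥ z)) = z ⬝ᵥ z := by
    rw [← mulVec_mulVec, ← mulVec_dotProduct_eq, mulVec_mulVec, nonsing_inv_mul _ hdet,
      one_mulVec]
  have h2 : (B *ᵥ z) ⬝ᵥ (B *ᵥ z) = z ⬝ᵥ (Y *ᵥ z) := by
    rw [mulVec_dotProduct_eq, mulVec_mulVec, hB]
  have h3 : 0 ≤ (B *ᵥ z) ⬝ᵥ (B *ᵥ z) := dotProduct_self_star_nonneg (B *ᵥ z)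
  rw [h1] at h
  rw [inv_mul_le_iff₀ (by positivity), ← h2]
  linarith

/-- Young's inequality: expand the form at t u − v, which is nonnegative, and divide by t. -/
lemma quad_add_le {P : Matrix ι ι ℝ} (hP : P.PosSemidef) (u v : ι → ℝ) {t : ℝ} (ht : 0 < t) :
    (u + v) ⬝ᵥ (P *ᵥ (u + v)) ≤ (1 + t) * (u ⬝ᵥ (P *ᵥ u)) + (1 + t⁻¹) * (v ⬝ᵥ (P *ᵥ v)) := by
  have h := hP.dotProduct_mulVec_nonneg (t • u - v)
  have hs := quad_comm (transpose_eq_of_posSemidef hP) u v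
  simp only [star_trivial, mulVec_sub, mulVec_smul, sub_dotProduct, dotProduct_sub,
    smul_dotProduct, dotProduct_smul, smul_eq_mul, mulVec_add, add_dotProduct,
    dotProduct_add, ← hs] at h ⊢
  have h' := mul_nonneg (inv_nonneg.mpr ht.le) h
  have e : t⁻¹ * t = 1 := inv_mul_cancel₀ ht.ne'
  have h2 : t⁻¹ * (t * (t * u ⬝ᵥ P *ᵥ u - u ⬝ᵥ P *ᵥ v) - (t * u ⬝ᵥ P *ᵥ v - v ⬝ᵥ P *ᵥ v))
      = (t⁻¹ * t) * (t * u ⬝ᵥ P *ᵥ u) - 2 * (t⁻¹ * t) * u ⬝ᵥ P *ᵥ v + t⁻¹ * v ⬝ᵥ P *ᵥ v := by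
    ring
  rw [h2, e] at h'
  linarith

/-- One step of F lowers the P-energy by zᵀYz ≥ c|z|², a fixed fraction of zᵀPz ≤ C|z|². Dividing by
C + c rather than C keeps the rate nonnegative. -/
lemma exists_contraction {P Y F : Matrix ι ι ℝ} (hY : Y.PosDef)
    (h : P = Fᵀ * P * F + Y) :
    ∃ γ : ℝ, γ < 1 ∧ 0 ≤ γ ∧
      ∀ z : ι → ℝ, (F *ᵥ z) ⬝ᵥ (P *ᵥ (F *ᵥ z)) ≤ γ * (z ⬝ᵥ (P *ᵥ z)) := by
  obtain ⟨c, hc, hcz⟩ := exists_le_quad hY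
  obtain ⟨C, hC, hCz⟩ := exists_abs_quad_le P
  refine ⟨1 - c / (C + c), by simp only [sub_lt_self_iff]; positivity, ?_, fun z => ?_⟩
  · rw [sub_nonneg, div_le_one (by positivity)]; linarith
  have h1 : z ⬝ᵥ (P *ᵥ z) = (F *ᵥ z) ⬝ᵥ (P *ᵥ (F *ᵥ z)) + z ⬝ᵥ (Y *ᵥ z) := by
    conv_lhs => rw [h]
    rw [add_mulVec, dotProduct_add, mulVec_dotProduct_eq, mulVec_mulVec, mulVec_mulVec,
      Matrix.mul_assoc]
  have h2 := (le_abs_self _).trans (hCz z)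
  have hz : 0 ≤ z ⬝ᵥ z := dotProduct_self_star_nonneg z
  have h3 : c / (C + c) * (z ⬝ᵥ (P *ᵥ z)) ≤ c * (z ⬝ᵥ z) := by
    rw [div_mul_eq_mul_div, div_le_iff₀ (by positivity)]
    have : z ⬝ᵥ (P *ᵥ z) ≤ (C + c) * (z ⬝ᵥ z) := by nlinarith
    nlinarith
  linarith [hcz z]

lemma tendsto_pow_zero_of_lyapunov [DecidableEq ι] {P Y F : Matrix ι ι ℝ} (hP : P.PosDef)
    (hY : Y.PosDef) (h : P = Fᵀ * P * F + Y) :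
    Tendsto (fun k : ℕ => F ^ k) atTop (𝓝 0) := by
  obtain ⟨γ, hγ1, hγ0, hγ⟩ := exists_contraction hY h
  obtain ⟨p, hp, hpz⟩ := exists_le_quad hP
  have hk : ∀ (k : ℕ) (z : ι → ℝ),
      ((F ^ k) *ᵥ z) ⬝ᵥ (P *ᵥ ((F ^ k) *ᵥ z)) ≤ γ ^ k * (z ⬝ᵥ (P *ᵥ z)) := by
    intro k z
    induction k with
    | zero => simp
    | succ k ih =>
      rw [pow_succ' F, ← mulVec_mulVec, pow_succ', mul_assoc]
      exact (hγ _).trans (mul_le_mul_of_nonneg_left ih hγ0)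
  -- The P-energy bounds the Euclidean norm since P is positive definite, so each column of F ^ k,
  -- the orbit of a basis vector, decays geometrically.
  refine tendsto_pi_nhds.mpr fun i => tendsto_pi_nhds.mpr fun j => ?_
  have hb : ∀ k : ℕ, ((F ^ k) i j) ^ 2 ≤
      p⁻¹ * (γ ^ k * ((Pi.single j 1 : ι → ℝ) ⬝ᵥ (P *ᵥ Pi.single j 1))) := by
    intro k
    have h1 := (hpz _).trans (hk k (Pi.single j 1))
    rw [← le_inv_mul_iff₀ hp] at h1
    refine le_trans ?_ h1
    rw [mulVec_single_one, sq]
    exact Finset.single_le_sum (f := fun i => (F ^ k).col j i * (F ^ k).col j i)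
      (fun i _ => mul_self_nonneg _) (Finset.mem_univ i)
  have hlim : Tendsto (fun k : ℕ =>
      p⁻¹ * (γ ^ k * ((Pi.single j 1 : ι → ℝ) ⬝ᵥ (P *ᵥ Pi.single j 1)))) atTop (𝓝 0) := by
    simpa using ((tendsto_pow_atTop_nhds_zero_of_lt_one hγ0 hγ1).mul_const _).const_mul p⁻¹
  have hsq := squeeze_zero (fun k => sq_nonneg ((F ^ k) i j)) hb hlim
  refine tendsto_zero_iff_abs_tendsto_zero _ |>.mpr ?_
  simpa [Function.comp_def, Real.sqrt_sq_eq_abs] using hsq.sqrt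

lemma posSemidef_lambdaMax_sub [DecidableEq ι] {K : Matrix ι ι ℝ} (hK : K.IsHermitian) :
    (lambdaMax K • (1 : Matrix ι ι ℝ) - K).PosSemidef := by
  rw [posSemidef_iff_isHermitian_and_spectrum_nonneg]
  refine ⟨(isHermitian_one.smul (.all _)).sub hK, ?_⟩
  rw [← Algebra.algebraMap_eq_smul_one, ← spectrum.singleton_sub_eq]
  rintro x ⟨a, rfl, y, hy, rfl⟩
  -- Finiteness makes the `sSup` in `lambdaMax` a genuine upper bound.
  have hfin : (spectrum ℝ K).Finite := by
    rw [hK.spectrum_real_eq_range_eigenvalues]; exact Set.finite_range _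
  exact sub_nonneg.mpr (le_csSup hfin.bddAbove hy)

lemma lambdaMax_nonneg [DecidableEq ι] {K : Matrix ι ι ℝ} (hK : K.PosSemidef) :
    0 ≤ lambdaMax K :=
  Real.sSup_nonneg fun _ hx => (posSemidef_iff_isHermitian_and_spectrum_nonneg.mp hK).2 hx

lemma trace_mul_le [DecidableEq ι] {s : ℝ} {P W : Matrix ι ι ℝ}
    (hP : (s • (1 : Matrix ι ι ℝ) - P).PosSemidef) (hW : W.PosSemidef) :
    (P * W).trace ≤ s * W.trace := by
  have h := trace_mul_nonneg hP hW
  rw [Matrix.sub_mul, trace_sub, smul_mul, Matrix.one_mul, trace_smul, smul_eq_mul] at h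
  linarith

/-- If 1 − F were singular, F would fix a nonzero vector, and its powers could not tend to zero. -/
lemma isUnit_det_one_sub_of_tendsto_pow [DecidableEq ι] {F : Matrix ι ι ℝ}
    (hF : Tendsto (fun k : ℕ => F ^ k) atTop (𝓝 0)) : IsUnit (1 - F).det := by
  by_contra h
  rw [isUnit_iff_ne_zero, not_not] at h
  obtain ⟨z, hz0, hz⟩ := exists_mulVec_eq_zero_iff.mpr h
  rw [sub_mulVec, one_mulVec, sub_eq_zero] at hz
  have hk : ∀ k : ℕ, F ^ k *ᵥ z = z := fun k => by
    induction k with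
    | zero => simp
    | succ k ih => rw [pow_succ, ← mulVec_mulVec, ← hz, ih]
  have hlim : Tendsto (fun k : ℕ => F ^ k *ᵥ z) atTop (𝓝 ((0 : Matrix ι ι ℝ) *ᵥ z)) :=
    ((continuous_id.matrix_mulVec continuous_const).tendsto 0).comp hF
  simp only [hk, zero_mulVec] at hlim
  exact hz0 (tendsto_nhds_unique tendsto_const_nhds hlim)

lemma tendsto_pow_transpose [DecidableEq ι] {F : Matrix ι ι ℝ}
    (hF : Tendsto (fun k : ℕ => F ^ k) atTop (𝓝 0)) :
    Tendsto (fun k : ℕ => Fᵀ ^ k) atTop (𝓝 0) := by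
  have h := ((continuous_id.matrix_transpose).tendsto (0 : Matrix ι ι ℝ)).comp hF
  simpa [Function.comp_def] using h

end QuadraticForms

/-! ### Algebra of the control and filter Riccati equations -/

section Riccati

variable {ι υ : Type*} [Fintype ι] [Fintype υ] [DecidableEq ι] [DecidableEq υ]

section Control

variable {A Q K : Matrix ι ι ℝ} {B : Matrix ι υ ℝ} {R : Matrix υ υ ℝ}

omit [DecidableEq ι] [DecidableEq υ] in
lemma inputWeight_posDef (hR : R.PosDef) (hK : K.PosSemidef) : (R + Bᵀ * K * B).PosDef := by
  have h := hK.conjTranspose_mul_mul_same B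
  rw [conjTranspose_eq_transpose_of_trivial] at h
  exact hR.add_posSemidef h

omit [DecidableEq ι] in
-- The gain solves (R + BᵀKB)L = −BᵀKA, so the bracket multiplying Lᵀ in the expanded right side
-- vanishes and the Riccati equation remains.
lemma control_lyapunov (hR : R.PosDef) (hK : K.PosSemidef)
    (hric : K = Aᵀ * K * A - Aᵀ * K * B * (R + Bᵀ * K * B)⁻¹ * Bᵀ * K * A + Q)
    {L : Matrix υ ι ℝ} (hL : L = -((R + Bᵀ * K * B)⁻¹ * Bᵀ * K * A)) :
    K = (A + B * L)ᵀ * K * (A + B * L) + (Lᵀ * R * L + Q) := by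
  have hS := (inputWeight_posDef (B := B) hR hK).det_pos.ne'.isUnit
  have hSL : (R + Bᵀ * K * B) * L = -(Bᵀ * K * A) := by
    rw [hL, Matrix.mul_neg, ← Matrix.mul_assoc, ← Matrix.mul_assoc, ← Matrix.mul_assoc,
      mul_nonsing_inv _ hS, Matrix.one_mul]
  have h1 : (A + B * L)ᵀ * K * (A + B * L) + (Lᵀ * R * L + Q)
      = Aᵀ * K * A + Aᵀ * K * B * L + Lᵀ * (Bᵀ * K * A + (R + Bᵀ * K * B) * L) + Q := by
    rw [transpose_add, transpose_mul]
    simp only [Matrix.add_mul, Matrix.mul_add, Matrix.mul_assoc]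
    abel
  rw [h1, hSL, add_neg_cancel, Matrix.mul_zero, add_zero]
  conv_lhs => rw [hric]
  rw [hL]
  simp only [Matrix.mul_neg, Matrix.mul_assoc, sub_eq_add_neg]

omit [DecidableEq ι] in
/-- `Lᵀ (R + Bᵀ K B) L = Aᵀ K A + Q - K`. -/
lemma gain_weight_eq (hR : R.PosDef) (hK : K.PosSemidef)
    (hric : K = Aᵀ * K * A - Aᵀ * K * B * (R + Bᵀ * K * B)⁻¹ * Bᵀ * K * A + Q)
    {L : Matrix υ ι ℝ} (hL : L = -((R + Bᵀ * K * B)⁻¹ * Bᵀ * K * A)) :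
    Lᵀ * (R + Bᵀ * K * B) * L = Aᵀ * K * A + Q - K := by
  have hS := (inputWeight_posDef (B := B) hR hK).det_pos.ne'.isUnit
  have hSt := transpose_eq_of_posSemidef (inputWeight_posDef (B := B) hR hK).posSemidef
  have hKt := transpose_eq_of_posSemidef hK
  have hSL : (R + Bᵀ * K * B) * L = -(Bᵀ * K * A) := by
    rw [hL, Matrix.mul_neg, ← Matrix.mul_assoc, ← Matrix.mul_assoc, ← Matrix.mul_assoc,
      mul_nonsing_inv _ hS, Matrix.one_mul]
  have hSL' : Lᵀ * (R + Bᵀ * K * B) = -(Aᵀ * K * B) := by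
    have h := congrArg transpose hSL
    rw [transpose_mul, hSt, transpose_neg, transpose_mul, transpose_mul, transpose_transpose,
      hKt] at h
    rw [h, Matrix.mul_assoc]
  rw [hSL', hL]
  nth_rewrite 5 [hric]
  simp only [Matrix.mul_neg, Matrix.neg_mul, neg_neg, Matrix.mul_assoc]
  abel

omit [DecidableEq ι] in
/-- Completion of squares in the Bellman equation of the tracking problem. -/
lemma tracking_bellman (hR : R.PosDef) (hK : K.PosSemidef) (hQ : Qᵀ = Q)
    (hric : K = Aᵀ * K * A - Aᵀ * K * B * (R + Bᵀ * K * B)⁻¹ * Bᵀ * K * A + Q)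
    {L M : Matrix υ ι ℝ} (hL : L = -((R + Bᵀ * K * B)⁻¹ * Bᵀ * K * A))
    (hM : M = -((R + Bᵀ * K * B)⁻¹ * Bᵀ))
    {g r : ι → ℝ} (hg : g = (A + B * L)ᵀ *ᵥ g - Q *ᵥ r)
    (x e w : ι → ℝ) {u : υ → ℝ} (hu : u = L *ᵥ (x - e) + M *ᵥ g)
    {x' : ι → ℝ} (hx' : x' = A *ᵥ x + B *ᵥ u + w) :
    (x - r) ⬝ᵥ (Q *ᵥ (x - r)) + u ⬝ᵥ (R *ᵥ u) =
      (x ⬝ᵥ (K *ᵥ x) + 2 * (g ⬝ᵥ x)) - (x' ⬝ᵥ (K *ᵥ x') + 2 * (g ⬝ᵥ x'))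
      + (w ⬝ᵥ (K *ᵥ w) + 2 * ((A *ᵥ x + B *ᵥ u) ⬝ᵥ (K *ᵥ w)) + 2 * (g ⬝ᵥ w))
      + r ⬝ᵥ (Q *ᵥ r) - g ⬝ᵥ ((B * (R + Bᵀ * K * B)⁻¹ * Bᵀ) *ᵥ g)
      + e ⬝ᵥ ((Lᵀ * (R + Bᵀ * K * B) * L) *ᵥ e) := by
  have hSpd := inputWeight_posDef (B := B) hR hK
  have hgw := gain_weight_eq hR hK hric hL
  set S := R + Bᵀ * K * B with hSdef
  have hS := hSpd.det_pos.ne'.isUnit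
  have hSt := transpose_eq_of_posSemidef hSpd.posSemidef
  have hKt := transpose_eq_of_posSemidef hK
  have hSL : S * L = -(Bᵀ * K * A) := by
    rw [hL, Matrix.mul_neg, ← Matrix.mul_assoc, ← Matrix.mul_assoc, ← Matrix.mul_assoc,
      mul_nonsing_inv _ hS, Matrix.one_mul]
  have hSM : S * M = -Bᵀ := by
    rw [hM, Matrix.mul_neg, ← Matrix.mul_assoc, mul_nonsing_inv _ hS, Matrix.one_mul]
  -- q is the input under exact knowledge of the state, where the quadratic S-form is centred; the
  -- input applied differs from it by L e.
  set q := L *ᵥ x + M *ᵥ g with hq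
  have huq : u = q - L *ᵥ e := by rw [hu, hq, mulVec_sub]; abel
  have hSq : S *ᵥ q = -((Bᵀ * K * A) *ᵥ x + Bᵀ *ᵥ g) := by
    rw [hq, mulVec_add, mulVec_mulVec, mulVec_mulVec, hSL, hSM, neg_mulVec, neg_mulVec]
    abel
  have hqSq : q ⬝ᵥ (S *ᵥ q) = x ⬝ᵥ ((Aᵀ * K * A + Q - K) *ᵥ x)
      - 2 * (x ⬝ᵥ ((B * L)ᵀ *ᵥ g)) + g ⬝ᵥ ((B * S⁻¹ * Bᵀ) *ᵥ g) := by
    have h1 : (M *ᵥ g) ⬝ᵥ (S *ᵥ (M *ᵥ g)) = g ⬝ᵥ ((B * S⁻¹ * Bᵀ) *ᵥ g) := by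
      rw [mulVec_mulVec, hSM, mulVec_dotProduct_eq, mulVec_mulVec, hM]
      simp [transpose_mul, transpose_nonsing_inv, hSt]
    have h2 : (L *ᵥ x) ⬝ᵥ (S *ᵥ (M *ᵥ g)) = -(x ⬝ᵥ ((B * L)ᵀ *ᵥ g)) := by
      rw [mulVec_mulVec, hSM, mulVec_dotProduct_eq, mulVec_mulVec, transpose_mul]
      simp [neg_mulVec]
    have h3 : (L *ᵥ x) ⬝ᵥ (S *ᵥ (L *ᵥ x)) = x ⬝ᵥ ((Aᵀ * K * A + Q - K) *ᵥ x) := by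
      rw [mulVec_dotProduct_eq, mulVec_mulVec, mulVec_mulVec, hgw]
    rw [hq, mulVec_add, add_dotProduct, dotProduct_add, dotProduct_add, h1, h2, h3,
      quad_comm hSt (M *ᵥ g), h2]
    ring
  have hee : (L *ᵥ e) ⬝ᵥ (S *ᵥ (L *ᵥ e)) = e ⬝ᵥ ((Lᵀ * S * L) *ᵥ e) := by
    rw [mulVec_dotProduct_eq, mulVec_mulVec, mulVec_mulVec]
  -- This is (u − q)ᵀS(u − q) = (Le)ᵀS(Le) expanded, the only way the estimation error enters.
  have huSu : u ⬝ᵥ (S *ᵥ u) = 2 * (u ⬝ᵥ (S *ᵥ q)) - q ⬝ᵥ (S *ᵥ q)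
      + e ⬝ᵥ ((Lᵀ * S * L) *ᵥ e) := by
    rw [← hee, huq]
    simp only [mulVec_sub, sub_dotProduct, dotProduct_sub, quad_comm hSt (L *ᵥ e) q]
    ring
  have huRu : u ⬝ᵥ (R *ᵥ u) = u ⬝ᵥ (S *ᵥ u) - (B *ᵥ u) ⬝ᵥ (K *ᵥ (B *ᵥ u)) := by
    rw [hSdef, add_mulVec, dotProduct_add, mulVec_dotProduct_eq, mulVec_mulVec, mulVec_mulVec,
      Matrix.mul_assoc]
    ring
  have huSq : u ⬝ᵥ (S *ᵥ q) = -((A *ᵥ x) ⬝ᵥ (K *ᵥ (B *ᵥ u)) + g ⬝ᵥ (B *ᵥ u)) := by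
    rw [hSq, dotProduct_neg, dotProduct_add, quad_comm hKt (A *ᵥ x), mulVec_dotProduct_eq,
      dotProduct_comm g, mulVec_dotProduct_eq]
    simp only [mulVec_mulVec, Matrix.mul_assoc]
  have hAA : (A *ᵥ x) ⬝ᵥ (K *ᵥ (A *ᵥ x)) = x ⬝ᵥ ((Aᵀ * K * A) *ᵥ x) := by
    rw [mulVec_dotProduct_eq, mulVec_mulVec, mulVec_mulVec, Matrix.mul_assoc]
  -- The fixed-point equation of g trades the tracking term xᵀQr for a difference of linear value
  -- terms.
  have hgx : g ⬝ᵥ x = x ⬝ᵥ (Aᵀ *ᵥ g) + x ⬝ᵥ ((B * L)ᵀ *ᵥ g) - x ⬝ᵥ (Q *ᵥ r) := by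
    conv_lhs => rw [hg]
    rw [dotProduct_comm, dotProduct_sub, transpose_add, add_mulVec, dotProduct_add]
  have hgA : g ⬝ᵥ (A *ᵥ x) = x ⬝ᵥ (Aᵀ *ᵥ g) := by
    rw [dotProduct_comm, mulVec_dotProduct_eq]
  rw [huRu, huSu, huSq, hqSq, hx']
  simp only [mulVec_add, mulVec_sub, sub_mulVec, add_mulVec, dotProduct_add, add_dotProduct,
    dotProduct_sub, sub_dotProduct, hgx, hgA, hAA, quad_comm hKt w, quad_comm hQ r x,
    quad_comm hKt (B *ᵥ u) (A *ᵥ x)]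
  ring

end Control

section Filter

variable {A C W V S : Matrix ι ι ℝ}

omit [DecidableEq ι] in
lemma innovation_posDef (hV : V.PosDef) (hS : S.PosSemidef) : (C * S * Cᵀ + V).PosDef := by
  have h := hS.mul_mul_conjTranspose_same C
  rw [conjTranspose_eq_transpose_of_trivial] at h
  exact PosDef.posSemidef_add h hV

/-- Reconciles the gain used by the algorithm with the usual Kalman gain: write SCᵀ = SCᵀZ⁻¹(CSCᵀ +
V) with Z = CSCᵀ + V, so that PCᵀ keeps only the V part. -/
lemma kalman_gain_eq (hV : V.PosDef) (hS : S.PosSemidef) {P : Matrix ι ι ℝ}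
    (hP : P = S - S * Cᵀ * (C * S * Cᵀ + V)⁻¹ * C * S) :
    P * Cᵀ * V⁻¹ = S * Cᵀ * (C * S * Cᵀ + V)⁻¹ := by
  have hZ := (innovation_posDef (C := C) hV hS).det_pos.ne'.isUnit
  have h : P * Cᵀ = S * Cᵀ * (C * S * Cᵀ + V)⁻¹ * V := by
    have h1 : S * Cᵀ = S * Cᵀ * (C * S * Cᵀ + V)⁻¹ * (C * S * Cᵀ + V) := by
      rw [Matrix.mul_assoc (S * Cᵀ), nonsing_inv_mul _ hZ, Matrix.mul_one]
    rw [hP, Matrix.sub_mul]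
    nth_rewrite 1 [h1]
    rw [Matrix.mul_add]
    simp only [Matrix.mul_assoc]
    abel
  rw [h, Matrix.mul_assoc _ V, mul_nonsing_inv _ hV.det_pos.ne'.isUnit, Matrix.mul_one]

/-- Joseph form of the measurement update. -/
lemma joseph_form (hV : V.PosDef) (hS : S.PosSemidef) {P G : Matrix ι ι ℝ}
    (hP : P = S - S * Cᵀ * (C * S * Cᵀ + V)⁻¹ * C * S) (hG : G = P * Cᵀ * V⁻¹) :
    P = (1 - G * C) * S * (1 - G * C)ᵀ + G * V * Gᵀ := by
  have hZp := innovation_posDef (C := C) hV hS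
  have hZ := hZp.det_pos.ne'.isUnit
  have hZt := transpose_eq_of_posSemidef hZp.posSemidef
  have hSt := transpose_eq_of_posSemidef hS
  rw [kalman_gain_eq hV hS hP] at hG
  have hGZ : G * (C * S * Cᵀ + V) = S * Cᵀ := by
    rw [hG, Matrix.mul_assoc, nonsing_inv_mul _ hZ, Matrix.mul_one]
  have h1 : (1 - G * C) * S * (1 - G * C)ᵀ + G * V * Gᵀ
      = S - G * C * S - S * Cᵀ * Gᵀ + G * (C * S * Cᵀ + V) * Gᵀ := by
    rw [transpose_sub, transpose_mul, transpose_one]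
    simp only [Matrix.sub_mul, Matrix.mul_sub, Matrix.one_mul, Matrix.mul_one, Matrix.mul_add,
      Matrix.add_mul, Matrix.mul_assoc]
    abel
  rw [h1, hGZ, hP, hG]
  abel

/-- The Riccati equation says that APAᵀ + W = S; inserted in the Joseph form, this makes P a fixed
point of the error covariance recursion. -/
lemma estimate_lyapunov (hV : V.PosDef) (hS : S.PosSemidef) {P G : Matrix ι ι ℝ}
    (hP : P = S - S * Cᵀ * (C * S * Cᵀ + V)⁻¹ * C * S) (hG : G = P * Cᵀ * V⁻¹)
    (hric : S = A * S * Aᵀ - A * S * Cᵀ * (C * S * Cᵀ + V)⁻¹ * C * S * Aᵀ + W) :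
    P = (1 - G * C) * (A * P * Aᵀ + W) * (1 - G * C)ᵀ + G * V * Gᵀ := by
  have h : A * P * Aᵀ + W = S := by
    conv_rhs => rw [hric]
    rw [hP]
    simp only [Matrix.sub_mul, Matrix.mul_sub, Matrix.mul_assoc]
  rw [h]
  exact joseph_form hV hS hP hG

/-- A vector z with Gᵀz = 0 is fixed by (1 − GC)ᵀ and is seen by W; any other z is seen by V. Thus 1
− GC need not be invertible. -/
lemma updated_noise_posDef (hV : V.PosDef) (hW : W.PosDef) (G : Matrix ι ι ℝ) :
    ((1 - G * C) * W * (1 - G * C)ᵀ + G * V * Gᵀ).PosDef := by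
  have h1 := hW.posSemidef.mul_mul_conjTranspose_same (1 - G * C)
  have h2 := hV.posSemidef.mul_mul_conjTranspose_same G
  rw [conjTranspose_eq_transpose_of_trivial] at h1 h2
  refine .of_dotProduct_mulVec_pos (h1.add h2).isHermitian fun z hz => ?_
  have e : ∀ T N : Matrix ι ι ℝ, z ⬝ᵥ ((T * N * Tᵀ) *ᵥ z) = (Tᵀ *ᵥ z) ⬝ᵥ (N *ᵥ (Tᵀ *ᵥ z)) :=
    fun T N => by
      rw [mulVec_dotProduct_eq, mulVec_mulVec, mulVec_mulVec, transpose_transpose,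
        Matrix.mul_assoc]
  rw [star_trivial, add_mulVec, dotProduct_add, e, e]
  by_cases hGz : Gᵀ *ᵥ z = 0
  · have h3 : (1 - G * C)ᵀ *ᵥ z = z := by
      rw [transpose_sub, transpose_one, transpose_mul, sub_mulVec, one_mulVec, ← mulVec_mulVec,
        hGz, mulVec_zero, sub_zero]
    rw [hGz, h3, zero_dotProduct, add_zero]
    exact hW.dotProduct_mulVec_pos hz
  · exact add_pos_of_nonneg_of_pos (hW.posSemidef.dotProduct_mulVec_nonneg _)
      (hV.dotProduct_mulVec_pos hGz)

/-- With Z = CSCᵀ + V, one has CPCᵀ = V − VZ⁻¹V ⪯ V ⪯ s CCᵀ, and C cancels: the filter does no worse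
than inverting a single measurement. -/
lemma updated_cov_le (hV : V.PosDef) (hS : S.PosSemidef) {P : Matrix ι ι ℝ}
    (hP : P = S - S * Cᵀ * (C * S * Cᵀ + V)⁻¹ * C * S) (hC : IsUnit C.det) {s : ℝ}
    (hs : (s • (C * Cᵀ) - V).PosSemidef) : (s • (1 : Matrix ι ι ℝ) - P).PosSemidef := by
  have hZp := innovation_posDef (C := C) hV hS
  have hZ := hZp.det_pos.ne'.isUnit
  have hVt := transpose_eq_of_posSemidef hV.posSemidef
  have hX : C * P * Cᵀ = V - V * (C * S * Cᵀ + V)⁻¹ * V := by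
    have hP' : C * P * Cᵀ = C * S * Cᵀ
        - (C * S * Cᵀ) * (C * S * Cᵀ + V)⁻¹ * (C * S * Cᵀ) := by
      rw [hP]
      simp only [Matrix.sub_mul, Matrix.mul_sub, Matrix.mul_assoc]
    rw [hP']
    generalize C * S * Cᵀ = X at hZ ⊢
    have hX : X = (X + V) - V := by abel
    have h1 : X * (X + V)⁻¹ * X = X - V + V * (X + V)⁻¹ * V := by
      have ha : X * (X + V)⁻¹ = 1 - V * (X + V)⁻¹ := by
        nth_rewrite 1 [hX]
        rw [Matrix.sub_mul, mul_nonsing_inv _ hZ]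
      have hb : (X + V)⁻¹ * X = 1 - (X + V)⁻¹ * V := by
        nth_rewrite 2 [hX]
        rw [Matrix.mul_sub, nonsing_inv_mul _ hZ]
      rw [ha, Matrix.sub_mul, Matrix.one_mul, Matrix.mul_assoc, hb, Matrix.mul_sub,
        Matrix.mul_one, Matrix.mul_assoc]
      abel
    rw [h1]
    abel
  have h2 : (C * (s • (1 : Matrix ι ι ℝ) - P) * Cᵀ).PosSemidef := by
    have h3 := hZp.inv.posSemidef.mul_mul_conjTranspose_same V
    rw [conjTranspose_eq_transpose_of_trivial, hVt] at h3
    have h4 := hs.add h3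
    rw [Matrix.mul_sub, Matrix.sub_mul, hX, Matrix.mul_smul, Matrix.mul_one, Matrix.smul_mul]
    convert h4 using 1
    abel
  have h5 := h2.mul_mul_conjTranspose_same C⁻¹
  rw [conjTranspose_eq_transpose_of_trivial, ← Matrix.mul_assoc, ← Matrix.mul_assoc,
    nonsing_inv_mul _ hC, Matrix.one_mul, Matrix.mul_assoc, ← transpose_mul,
    nonsing_inv_mul _ hC, transpose_one, Matrix.mul_one] at h5
  exact h5

end Filter

end Riccati

/-! ### Second-moment matrices and orthogonality of random vectors -/

section SecondMoments

variable {Ω : Type*} [MeasurableSpace Ω] {μ : Measure Ω}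
variable {ι κ τ : Type*} [Fintype ι] [Fintype κ] [Fintype τ]

/-- The coordinates of the random vector `X` have finite second moments. -/
def SquareIntegrable (μ : Measure Ω) (X : Ω → ι → ℝ) : Prop :=
  ∀ i, MemLp (fun ω => X ω i) 2 μ

/-- The matrix `E[X Yᵀ]`. -/
def crossMoment (μ : Measure Ω) (X : Ω → ι → ℝ) (Y : Ω → κ → ℝ) : Matrix ι κ ℝ :=
  of fun i j => ∫ ω, X ω i * Y ω j ∂μ

namespace SquareIntegrable

variable {X X' : Ω → ι → ℝ} {Y Y' : Ω → κ → ℝ}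

omit [Fintype ι] in
lemma add (hX : SquareIntegrable μ X) (hX' : SquareIntegrable μ X') :
    SquareIntegrable μ (fun ω => X ω + X' ω) := fun i => (hX i).add (hX' i)

omit [Fintype ι] in
lemma sub (hX : SquareIntegrable μ X) (hX' : SquareIntegrable μ X') :
    SquareIntegrable μ (fun ω => X ω - X' ω) := fun i => (hX i).sub (hX' i)

omit [Fintype κ] in
lemma mulVec (hX : SquareIntegrable μ X) (A : Matrix κ ι ℝ) :
    SquareIntegrable μ (fun ω => A *ᵥ X ω) := fun i =>
  memLp_finsetSum _ fun j _ => (hX j).const_mul (A i j)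

omit [Fintype ι] in
lemma const [IsFiniteMeasure μ] (c : ι → ℝ) : SquareIntegrable μ (fun _ => c) :=
  fun i => memLp_const (c i)

omit [Fintype ι] [Fintype κ] in
lemma integrable_mul (hX : SquareIntegrable μ X) (hY : SquareIntegrable μ Y) (i : ι) (j : κ) :
    Integrable (fun ω => X ω i * Y ω j) μ := (hX i).integrable_mul (hY j)

lemma integrable_dotProduct (hX : SquareIntegrable μ X) (hX' : SquareIntegrable μ X') :
    Integrable (fun ω => X ω ⬝ᵥ X' ω) μ :=
  integrable_finsetSum _ fun i _ => hX.integrable_mul hX' i i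

lemma integrable_quad (hX : SquareIntegrable μ X) (A : Matrix ι κ ℝ) (hY : SquareIntegrable μ Y) :
    Integrable (fun ω => X ω ⬝ᵥ (A *ᵥ Y ω)) μ :=
  hX.integrable_dotProduct (hY.mulVec A)

end SquareIntegrable

variable {X X' : Ω → ι → ℝ} {Y Y' : Ω → κ → ℝ}

omit [Fintype ι] [Fintype κ] in
lemma crossMoment_transpose (X : Ω → ι → ℝ) (Y : Ω → κ → ℝ) :
    (crossMoment μ X Y)ᵀ = crossMoment μ Y X := by
  ext i j
  simp only [crossMoment, transpose_apply, of_apply, mul_comm]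

omit [Fintype ι] [Fintype κ] in
lemma crossMoment_add_left (hX : SquareIntegrable μ X) (hX' : SquareIntegrable μ X')
    (hY : SquareIntegrable μ Y) :
    crossMoment μ (fun ω => X ω + X' ω) Y = crossMoment μ X Y + crossMoment μ X' Y := by
  ext i j
  simp only [crossMoment, of_apply, Matrix.add_apply, Pi.add_apply, add_mul]
  exact integral_add (hX.integrable_mul hY i j) (hX'.integrable_mul hY i j)

omit [Fintype ι] [Fintype κ] in
lemma crossMoment_sub_left (hX : SquareIntegrable μ X) (hX' : SquareIntegrable μ X')
    (hY : SquareIntegrable μ Y) :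
    crossMoment μ (fun ω => X ω - X' ω) Y = crossMoment μ X Y - crossMoment μ X' Y := by
  ext i j
  simp only [crossMoment, of_apply, Matrix.sub_apply, Pi.sub_apply, sub_mul]
  exact integral_sub (hX.integrable_mul hY i j) (hX'.integrable_mul hY i j)

omit [Fintype κ] [Fintype τ] in
lemma crossMoment_mulVec_left (A : Matrix τ ι ℝ) (hX : SquareIntegrable μ X)
    (hY : SquareIntegrable μ Y) :
    crossMoment μ (fun ω => A *ᵥ X ω) Y = A * crossMoment μ X Y := by
  ext i j
  simp only [crossMoment, of_apply, Matrix.mul_apply, mulVec, dotProduct, Finset.sum_mul]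
  rw [integral_finsetSum _ fun k _ => by
    simpa only [mul_assoc] using (hX.integrable_mul hY k j).const_mul (A i k)]
  simp only [mul_assoc, integral_const_mul]

omit [Fintype ι] [Fintype κ] in
lemma crossMoment_add_right (hX : SquareIntegrable μ X) (hY : SquareIntegrable μ Y)
    (hY' : SquareIntegrable μ Y') :
    crossMoment μ X (fun ω => Y ω + Y' ω) = crossMoment μ X Y + crossMoment μ X Y' := by
  rw [← crossMoment_transpose, crossMoment_add_left hY hY' hX, transpose_add,
    crossMoment_transpose, crossMoment_transpose]

omit [Fintype ι] [Fintype κ] in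
lemma crossMoment_sub_right (hX : SquareIntegrable μ X) (hY : SquareIntegrable μ Y)
    (hY' : SquareIntegrable μ Y') :
    crossMoment μ X (fun ω => Y ω - Y' ω) = crossMoment μ X Y - crossMoment μ X Y' := by
  rw [← crossMoment_transpose, crossMoment_sub_left hY hY' hX, transpose_sub,
    crossMoment_transpose, crossMoment_transpose]

omit [Fintype ι] [Fintype τ] in
lemma crossMoment_mulVec_right (A : Matrix τ κ ℝ) (hX : SquareIntegrable μ X)
    (hY : SquareIntegrable μ Y) :
    crossMoment μ X (fun ω => A *ᵥ Y ω) = crossMoment μ X Y * Aᵀ := by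
  rw [← crossMoment_transpose, crossMoment_mulVec_left A hY hX, transpose_mul,
    crossMoment_transpose]

lemma integral_quad (hX : SquareIntegrable μ X) (A : Matrix ι κ ℝ) (hY : SquareIntegrable μ Y) :
    ∫ ω, X ω ⬝ᵥ (A *ᵥ Y ω) ∂μ = (A * crossMoment μ Y X).trace := by
  have hA := hY.mulVec A
  rw [← crossMoment_mulVec_left A hY hX]
  simp only [dotProduct, trace, diag_apply, crossMoment, of_apply]
  rw [integral_finsetSum _ fun i _ => hX.integrable_mul hA i i]
  simp only [mul_comm]

lemma integral_dotProduct (hX : SquareIntegrable μ X) (hX' : SquareIntegrable μ X') :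
    ∫ ω, X ω ⬝ᵥ X' ω ∂μ = (crossMoment μ X' X).trace := by
  classical
  simpa using integral_quad hX (1 : Matrix ι ι ℝ) hX'

omit [Fintype ι] [Fintype κ] in
lemma crossMoment_const_left (c : κ → ℝ) (hX : ∀ i, ∫ ω, X ω i ∂μ = 0) :
    crossMoment μ (fun _ => c) X = 0 := by
  ext i j
  simp [crossMoment, integral_const_mul, hX]

/-- `X` is square integrable and orthogonal to `Y`. -/
structure Orthogonal (μ : Measure Ω) (X : Ω → ι → ℝ) (Y : Ω → κ → ℝ) : Prop where
  left : SquareIntegrable μ X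
  right : SquareIntegrable μ Y
  crossMoment_eq : crossMoment μ X Y = 0

namespace Orthogonal

omit [Fintype ι] [Fintype κ] in
lemma symm (h : Orthogonal μ X Y) : Orthogonal μ Y X :=
  ⟨h.right, h.left, by rw [← crossMoment_transpose, h.crossMoment_eq, transpose_zero]⟩

omit [Fintype ι] [Fintype κ] in
lemma add_left (h : Orthogonal μ X Y) (h' : Orthogonal μ X' Y) :
    Orthogonal μ (fun ω => X ω + X' ω) Y :=
  ⟨h.left.add h'.left, h.right, by
    rw [crossMoment_add_left h.left h'.left h.right, h.crossMoment_eq, h'.crossMoment_eq, add_zero]⟩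

omit [Fintype ι] [Fintype κ] in
lemma sub_left (h : Orthogonal μ X Y) (h' : Orthogonal μ X' Y) :
    Orthogonal μ (fun ω => X ω - X' ω) Y :=
  ⟨h.left.sub h'.left, h.right, by
    rw [crossMoment_sub_left h.left h'.left h.right, h.crossMoment_eq, h'.crossMoment_eq, sub_zero]⟩

omit [Fintype κ] [Fintype τ] in
lemma mulVec_left (h : Orthogonal μ X Y) (A : Matrix τ ι ℝ) :
    Orthogonal μ (fun ω => A *ᵥ X ω) Y :=
  ⟨h.left.mulVec A, h.right, by
    rw [crossMoment_mulVec_left A h.left h.right, h.crossMoment_eq, Matrix.mul_zero]⟩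

omit [Fintype ι] [Fintype τ] in
lemma mulVec_right (h : Orthogonal μ X Y) (A : Matrix τ κ ℝ) :
    Orthogonal μ X (fun ω => A *ᵥ Y ω) := (h.symm.mulVec_left A).symm

omit [Fintype ι] [Fintype κ] in
lemma const_left [IsFiniteMeasure μ] (c : ι → ℝ) (hY : SquareIntegrable μ Y)
    (h0 : ∀ j, ∫ ω, Y ω j ∂μ = 0) : Orthogonal μ (fun _ => c) Y :=
  ⟨.const c, hY, crossMoment_const_left c h0⟩

lemma integral_quad_eq_zero (h : Orthogonal μ X Y) (A : Matrix ι κ ℝ) :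
    ∫ ω, X ω ⬝ᵥ (A *ᵥ Y ω) ∂μ = 0 := by
  rw [integral_quad h.left A h.right, h.symm.crossMoment_eq, Matrix.mul_zero, trace_zero]

lemma integral_dotProduct_eq_zero (h : Orthogonal μ X X') : ∫ ω, X ω ⬝ᵥ X' ω ∂μ = 0 := by
  rw [integral_dotProduct h.left h.right, h.symm.crossMoment_eq, trace_zero]

omit [Fintype ι] in
lemma crossMoment_add_self (h : Orthogonal μ X X') :
    crossMoment μ (fun ω => X ω + X' ω) (fun ω => X ω + X' ω)
      = crossMoment μ X X + crossMoment μ X' X' := by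
  rw [crossMoment_add_left h.left h.right (h.left.add h.right),
    crossMoment_add_right h.left h.left h.right, crossMoment_add_right h.right h.left h.right,
    h.crossMoment_eq, h.symm.crossMoment_eq, add_zero, zero_add]

omit [Fintype ι] in
lemma crossMoment_sub_self (h : Orthogonal μ X X') :
    crossMoment μ (fun ω => X ω - X' ω) (fun ω => X ω - X' ω)
      = crossMoment μ X X + crossMoment μ X' X' := by
  rw [crossMoment_sub_left h.left h.right (h.left.sub h.right),
    crossMoment_sub_right h.left h.left h.right, crossMoment_sub_right h.right h.left h.right,
    h.crossMoment_eq, h.symm.crossMoment_eq, sub_zero, zero_sub, sub_neg_eq_add]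

end Orthogonal

end SecondMoments

/-! ### Moments of centred Gaussian vectors -/

section GaussianVectors

variable {Ω : Type*} [MeasurableSpace Ω] {μ : Measure Ω} {ι : Type*} [Fintype ι] [DecidableEq ι]
  {X : Ω → ι → ℝ} {S : Matrix ι ι ℝ}

lemma memLp_of_hasLaw_gaussian (h : HasLaw (fun ω => WithLp.toLp 2 (X ω))
    (multivariateGaussian 0 S) μ) : SquareIntegrable μ X := fun i => by
  have h1 : MemLp (fun x : EuclideanSpace ℝ ι => x i) 2 (multivariateGaussian 0 S) := by
    have h2 := (IsGaussian.memLp_two_id (μ := multivariateGaussian (0 : EuclideanSpace ℝ ι) S))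
    exact (EuclideanSpace.proj (𝕜 := ℝ) i).comp_memLp' h2
  rw [← h.map_eq] at h1
  exact h1.comp_of_map h.aemeasurable

lemma integral_of_hasLaw_gaussian (h : HasLaw (fun ω => WithLp.toLp 2 (X ω))
    (multivariateGaussian 0 S) μ) (i : ι) : ∫ ω, X ω i ∂μ = 0 := by
  have h1 := h.integral_comp (f := fun x : EuclideanSpace ℝ ι => x i)
    (by fun_prop)
  have h2 := (EuclideanSpace.proj (𝕜 := ℝ) i).integral_comp_id_comm
    (IsGaussian.integrable_id (μ := multivariateGaussian (0 : EuclideanSpace ℝ ι) S))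
  rw [integral_id_multivariateGaussian, map_zero] at h2
  exact h1.trans h2

lemma covariance_of_hasLaw_gaussian (hS : S.PosSemidef)
    (h : HasLaw (fun ω => WithLp.toLp 2 (X ω)) (multivariateGaussian 0 S) μ) (i j : ι) :
    ∫ ω, X ω i * X ω j ∂μ = S i j := by
  have h1 := h.covariance_fun_comp (f := fun x : EuclideanSpace ℝ ι => x i)
    (g := fun x => x j) (by fun_prop) (by fun_prop)
  rw [covariance_eval_multivariateGaussian hS] at h1
  rw [← h1, covariance]
  simp only [integral_of_hasLaw_gaussian h, sub_zero]

end GaussianVectors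

/-! ### The Gaussian tail and the noise level of the Gaussian mechanism -/

section GaussianTail

lemma integrable_exp_neg_sq_div_two : Integrable fun z : ℝ => Real.exp (-z ^ 2 / 2) := by
  have h := integrable_exp_neg_mul_sq (b := 1 / 2) (by norm_num)
  convert h using 3
  ring

lemma gaussianTail_continuous : Continuous gaussianTail := by
  have hint := integrable_exp_neg_sq_div_two
  have h : gaussianTail = fun y => (1 / √(2 * Real.pi)) *
      ((∫ z in Set.Ioi (0 : ℝ), Real.exp (-z ^ 2 / 2))
        - ∫ z in (0 : ℝ)..y, Real.exp (-z ^ 2 / 2)) := by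
    funext y
    rw [gaussianTail, ← intervalIntegral.integral_interval_add_Ioi hint.integrableOn
      (a := 0) (b := y) hint.integrableOn, add_sub_cancel_left]
  rw [h]
  exact continuous_const.mul (continuous_const.sub
    (intervalIntegral.continuous_primitive (fun _ _ => hint.intervalIntegrable) 0))

lemma gaussianTail_zero : gaussianTail 0 = 1 / 2 := by
  have h := integral_gaussian_Ioi (1 / 2)
  have e : (fun z : ℝ => Real.exp (-z ^ 2 / 2)) = fun z => Real.exp (-(1 / 2) * z ^ 2) := by
    funext z; congr 1; ring
  rw [gaussianTail, e, h, show Real.pi / (1 / 2) = 2 * Real.pi by ring]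
  have : √(2 * Real.pi) ≠ 0 := by positivity
  field_simp

lemma gaussianTail_antitone : Antitone gaussianTail := fun a b hab => by
  unfold gaussianTail
  refine mul_le_mul_of_nonneg_left ?_ (by positivity)
  exact setIntegral_mono_set integrable_exp_neg_sq_div_two.integrableOn
    (Eventually.of_forall fun z => (Real.exp_pos _).le) (Set.Ioi_subset_Ioi hab).eventuallyLE

/-- Mills' inequality. -/
lemma gaussianTail_le {y : ℝ} (hy : 0 < y) :
    gaussianTail y ≤ 1 / √(2 * Real.pi) * (Real.exp (-y ^ 2 / 2) / y) := by
  unfold gaussianTail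
  refine mul_le_mul_of_nonneg_left ?_ (by positivity)
  -- Inserting the factor z / y ≥ 1 gives an integrand with an elementary primitive.
  have hderiv : ∀ z ∈ Set.Ici y, HasDerivAt (fun z : ℝ => -Real.exp (-z ^ 2 / 2) / y)
      (z / y * Real.exp (-z ^ 2 / 2)) z := fun z _ => by
    have h1 : HasDerivAt (fun z : ℝ => -z ^ 2 / 2) (-z) z := by
      refine ((hasDerivAt_pow 2 z).neg.div_const 2).congr_deriv ?_
      norm_num
      ring
    refine (h1.exp.neg.div_const y).congr_deriv ?_
    ring
  have hpos : ∀ z ∈ Set.Ioi y, 0 ≤ z / y * Real.exp (-z ^ 2 / 2) := fun z hz =>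
    mul_nonneg (div_nonneg (hy.trans hz).le hy.le) (Real.exp_pos _).le
  have hlim : Tendsto (fun z : ℝ => -Real.exp (-z ^ 2 / 2) / y) atTop (𝓝 0) := by
    have h1 : Tendsto (fun z : ℝ => -z ^ 2 / 2) atTop atBot := by
      have := (tendsto_pow_atTop (α := ℝ) two_ne_zero).const_mul_atTop_of_neg
        (show (-1 / 2 : ℝ) < 0 by norm_num)
      exact this.congr fun z => by ring
    simpa using ((Real.tendsto_exp_atBot.comp h1).neg.div_const y)
  have hint := integrableOn_Ioi_deriv_of_nonneg' hderiv hpos hlim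
  have hval := integral_Ioi_of_hasDerivAt_of_nonneg' hderiv hpos hlim
  calc ∫ z in Set.Ioi y, Real.exp (-z ^ 2 / 2)
      ≤ ∫ z in Set.Ioi y, z / y * Real.exp (-z ^ 2 / 2) := by
        refine setIntegral_mono_on integrable_exp_neg_sq_div_two.integrableOn hint
          measurableSet_Ioi fun z hz => ?_
        exact le_mul_of_one_le_left (Real.exp_pos _).le ((one_le_div hy).mpr (le_of_lt hz))
    _ = Real.exp (-y ^ 2 / 2) / y := by rw [hval]; ring

/-- The bound 9/2 on K_δ is the source of the 36 = 4 · 2 · (9/2) in the privacy condition. -/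
lemma gaussianTail_nine_halves_lt : gaussianTail (9 / 2) < (10 : ℝ) ^ (-5 : ℤ) := by
  have h1 : (5 / 2 : ℝ) ≤ √(2 * Real.pi) := by
    apply Real.le_sqrt_of_sq_le
    linarith [Real.pi_gt_d2]
  have h2 : Real.exp (-(9 / 2) ^ 2 / 2) ≤ ((2.7 : ℝ) ^ 10)⁻¹ := by
    rw [show (-(9 / 2 : ℝ) ^ 2 / 2) = -(81 / 8) by norm_num, Real.exp_neg]
    refine inv_anti₀ (by positivity) ?_
    calc (2.7 : ℝ) ^ 10 ≤ Real.exp 1 ^ 10 :=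
          pow_le_pow_left₀ (by norm_num) (by linarith [Real.exp_one_gt_d9]) _
      _ = Real.exp 10 := by rw [← Real.exp_nat_mul]; norm_num
      _ ≤ Real.exp (81 / 8) := Real.exp_le_exp.mpr (by norm_num)
  calc gaussianTail (9 / 2) ≤ 1 / √(2 * Real.pi) * (Real.exp (-(9 / 2) ^ 2 / 2) / (9 / 2)) :=
        gaussianTail_le (by norm_num)
    _ ≤ 1 / (5 / 2) * (((2.7 : ℝ) ^ 10)⁻¹ / (9 / 2)) := by gcongr
    _ < (10 : ℝ) ^ (-5 : ℤ) := by norm_num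

lemma gaussianTailInv_le {δ : ℝ} (h : δ ∈ Set.Icc ((10 : ℝ) ^ (-5 : ℤ)) ((10 : ℝ) ^ (-1 : ℤ))) :
    gaussianTailInv δ ≤ 9 / 2 := by
  -- `Function.invFun` is meaningful only at attained values; the intermediate value theorem on [0,
  -- 9/2] shows that δ is one.
  have hex : ∃ y, gaussianTail y = δ := by
    have h1 : δ ∈ Set.Icc (gaussianTail (9 / 2)) (gaussianTail 0) := by
      rw [gaussianTail_zero]
      refine ⟨(gaussianTail_nine_halves_lt.le.trans h.1), h.2.trans (by norm_num)⟩
    obtain ⟨y, -, hy⟩ := intermediate_value_Icc' (by norm_num) gaussianTail_continuous.continuousOn h1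
    exact ⟨y, hy⟩
  have hinv : gaussianTail (gaussianTailInv δ) = δ := Function.invFun_eq hex
  by_contra hlt
  have := gaussianTail_antitone (not_le.mp hlt).le
  exact absurd (hinv ▸ this) (not_le.mpr (gaussianTail_nine_halves_lt.trans_le h.1))

/-- With s = √(2ε) the noise level is at most Δ(9 + s)/s², so it suffices that ηs² − s − 9 ≥ 0. The
positive root is s = (1 + √(36η + 1))/(2η), and ε = s²/2 gives the stated threshold. -/
lemma gaussianMechanismStd_le {Δ ε δ η : ℝ} (hΔ : 0 ≤ Δ) (hε : 0 < ε) (hη : 0 < η)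
    (hδ : δ ∈ Set.Icc ((10 : ℝ) ^ (-5 : ℤ)) ((10 : ℝ) ^ (-1 : ℤ)))
    (h : ε ≥ 1 / 8 * ((1 + √(36 * η + 1)) / η) ^ 2) :
    gaussianMechanismStd Δ ε δ ≤ Δ * η := by
  have hk := gaussianTailInv_le hδ
  unfold gaussianMechanismStd
  set κ := gaussianTailInv δ
  have hs0 : 0 ≤ √(2 * ε) := Real.sqrt_nonneg _
  have hss : √(2 * ε) ^ 2 = 2 * ε := Real.sq_sqrt (by positivity)
  have h1 : κ + √(κ ^ 2 + 2 * ε) ≤ 9 + √(2 * ε) := by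
    have h2 : √(κ ^ 2 + 2 * ε) ≤ |κ| + √(2 * ε) := by
      apply Real.sqrt_le_iff.mpr
      refine ⟨by positivity, ?_⟩
      nlinarith [sq_abs κ, mul_nonneg (abs_nonneg κ) hs0]
    -- κ + |κ| is 2κ ≤ 9 or 0.
    rcases abs_cases κ with ⟨h3, _⟩ | ⟨h3, _⟩ <;> rw [h3] at h2 <;> linarith
  have hr0 : 0 ≤ √(36 * η + 1) := Real.sqrt_nonneg _
  have hrr : √(36 * η + 1) ^ 2 = 36 * η + 1 := Real.sq_sqrt (by positivity)
  have h4 : 1 + √(36 * η + 1) ≤ 2 * √(2 * ε) * η := by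
    rw [← div_le_iff₀ hη]
    refine le_of_sq_le_sq ?_ (by positivity)
    rw [mul_pow, hss]
    linarith
  have h5 : 9 + √(2 * ε) ≤ 2 * ε * η := by
    have h6 : 36 * η + 1 ≤ (2 * √(2 * ε) * η - 1) ^ 2 := by
      rw [← hrr]
      exact pow_le_pow_left₀ hr0 (by linarith) 2
    have h7 : 36 * η + 4 * η * √(2 * ε) ≤ 4 * η * (2 * ε * η) := by
      have e : 4 * η * (2 * ε * η) = (2 * √(2 * ε) * η) ^ 2 := by
        rw [mul_pow, mul_pow, hss]; ring
      rw [e]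
      linarith
    have h8 : 4 * η * (9 + √(2 * ε)) ≤ 4 * η * (2 * ε * η) := by linarith
    exact le_of_mul_le_mul_left h8 (by positivity)
  rw [div_mul_eq_mul_div, div_le_iff₀ (by positivity)]
  calc Δ * (κ + √(κ ^ 2 + 2 * ε)) ≤ Δ * (2 * ε * η) :=
        mul_le_mul_of_nonneg_left (h1.trans h5) hΔ
    _ = Δ * η * (2 * ε) := by ring

lemma gaussianMechanismStd_pos {Δ ε δ : ℝ} (hΔ : 0 < Δ) (hε : 0 < ε) :
    0 < gaussianMechanismStd Δ ε δ := by
  unfold gaussianMechanismStd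
  refine mul_pos (by positivity) ?_
  have h : |gaussianTailInv δ| < √(gaussianTailInv δ ^ 2 + 2 * ε) := by
    rw [← Real.sqrt_sq_eq_abs]
    exact Real.sqrt_lt_sqrt (sq_nonneg _) (by linarith)
  linarith [neg_abs_le (gaussianTailInv δ)]

end GaussianTail

/-! ### The output sensitivity is finite and nonzero -/

section Sensitivity

lemma trajNorm_le_mul {q d : ℕ} {z : ℕ → Fin d → ℝ} {y : ℕ → Fin q → ℝ} {c : ℝ}
    (h : ∀ k, y k ⬝ᵥ y k ≤ c ^ 2 * (z k ⬝ᵥ z k)) (hc : 0 ≤ c) :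
    trajNorm y ≤ ENNReal.ofReal c * trajNorm z := by
  unfold trajNorm
  have hsum : ∀ {e : ℕ} (x : Fin e → ℝ),
      ∑ a, ENNReal.ofReal (x a ^ 2) = ENNReal.ofReal (x ⬝ᵥ x) := fun x => by
    rw [dotProduct, ENNReal.ofReal_sum_of_nonneg fun a _ => mul_self_nonneg _]
    simp only [sq]
  have h1 : ∑' k, ∑ a, ENNReal.ofReal (y k a ^ 2)
      ≤ ENNReal.ofReal c ^ (2 : ℝ) * ∑' k, ∑ a, ENNReal.ofReal (z k a ^ 2) := by
    rw [← ENNReal.tsum_mul_left]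
    refine ENNReal.tsum_le_tsum fun k => ?_
    rw [hsum, hsum, ENNReal.ofReal_rpow_of_nonneg hc (by norm_num),
      ← ENNReal.ofReal_mul (by positivity)]
    exact ENNReal.ofReal_le_ofReal (by exact_mod_cast h k)
  calc _ ≤ (ENNReal.ofReal c ^ (2 : ℝ) * ∑' k, ∑ a, ENNReal.ofReal (z k a ^ 2)) ^ (1 / 2 : ℝ) :=
        ENNReal.rpow_le_rpow h1 (by norm_num)
    _ = _ := by
        rw [ENNReal.mul_rpow_of_nonneg _ _ (by norm_num), ← ENNReal.rpow_mul]
        norm_num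

/-- `Network.sens` is a `toReal`, which would be 0 at ∞; finiteness is thus needed for positive
noise levels. -/
lemma outputSensitivity_ne_top {q d : ℕ} (C : Matrix (Fin q) (Fin d) ℝ) (b : ℝ) :
    outputSensitivity C b ≠ ∞ := by
  obtain ⟨c, hc, hcz⟩ := exists_abs_quad_le (Cᵀ * C)
  have h : outputSensitivity C b ≤ ENNReal.ofReal √c * ENNReal.ofReal b := by
    refine iSup_le fun x => iSup_le fun x' => iSup_le fun hx => ?_
    refine (trajNorm_le_mul (z := fun k => x k - x' k) (fun k => ?_) (Real.sqrt_nonneg c)).trans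
      (mul_le_mul_right hx _)
    rw [Real.sq_sqrt hc, ← mulVec_sub, mulVec_dotProduct_eq, mulVec_mulVec]
    exact (le_abs_self _).trans (hcz _)
  exact ne_top_of_le_ne_top (by finiteness) h

lemma outputSensitivity_ne_zero {q d : ℕ} {C : Matrix (Fin q) (Fin d) ℝ} {b : ℝ} (hb : 0 < b)
    {a : Fin q} {a' : Fin d} (hC : C a a' ≠ 0) : outputSensitivity C b ≠ 0 := by
  -- An impulse of size b at time 0 in the direction a' is adjacent to the zero trajectory and has
  -- nonzero output.
  set x : ℕ → Fin d → ℝ := fun k => if k = 0 then b • Pi.single a' 1 else 0 with hx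
  have hnorm : trajNorm (fun k => x k - (0 : ℕ → Fin d → ℝ) k) ≤ ENNReal.ofReal b := by
    unfold trajNorm
    rw [tsum_eq_single 0 (fun k hk => by simp [hx, hk]), Finset.sum_eq_single a'
      (fun c _ hc => by simp [hx, hc]) (by simp)]
    simp only [hx, if_true, Pi.zero_apply, sub_zero, Pi.smul_apply, Pi.single_eq_same,
      smul_eq_mul, mul_one]
    rw [ENNReal.ofReal_rpow_of_nonneg (by positivity) (by norm_num), ← Real.sqrt_eq_rpow,
      Real.sqrt_sq hb.le]
  have hle : trajNorm (fun k => C *ᵥ x k - C *ᵥ (0 : ℕ → Fin d → ℝ) k) ≤ outputSensitivity C b :=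
    le_iSup_of_le x (le_iSup_of_le 0 (le_iSup_of_le hnorm le_rfl))
  refine (lt_of_lt_of_le ?_ hle).ne'
  unfold trajNorm
  refine ENNReal.rpow_pos ?_ ?_
  · have h0 : ENNReal.ofReal ((C *ᵥ x 0 - C *ᵥ (0 : ℕ → Fin d → ℝ) 0) a ^ 2) ≠ 0 := by
      have : (C *ᵥ x 0 - C *ᵥ (0 : ℕ → Fin d → ℝ) 0) a = b * C a a' := by
        simp [hx, mulVec_smul]
      rw [this]
      have : 0 < (b * C a a') ^ 2 := by positivity
      exact (ENNReal.ofReal_pos.mpr this).ne'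
    refine (pos_iff_ne_zero.mpr h0).trans_le (le_trans ?_ (ENNReal.le_tsum 0))
    exact Finset.single_le_sum
      (f := fun a => ENNReal.ofReal ((C *ᵥ x 0 - C *ᵥ (0 : ℕ → Fin d → ℝ) 0) a ^ 2))
      (fun _ _ => zero_le) (Finset.mem_univ a)
  · rw [tsum_eq_single 0 (fun k hk => by simp [hx, hk])]
    exact ENNReal.sum_ne_top.mpr fun _ _ => ENNReal.ofReal_ne_top

end Sensitivity

/-! ### Stable linear recursions and averages -/

section LinearRecursion

variable {Ω : Type*} [MeasurableSpace Ω] {μ : Measure Ω} {ι : Type*} [Fintype ι]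

lemma integral_quad_nonneg {P : Matrix ι ι ℝ} (hP : P.PosSemidef) (X : Ω → ι → ℝ) :
    0 ≤ ∫ ω, X ω ⬝ᵥ (P *ᵥ X ω) ∂μ :=
  integral_nonneg fun ω => hP.dotProduct_mulVec_nonneg (X ω)

lemma integral_quad_add_le {P : Matrix ι ι ℝ} (hP : P.PosSemidef) {X Y : Ω → ι → ℝ}
    (hX : SquareIntegrable μ X) (hY : SquareIntegrable μ Y) {t : ℝ} (ht : 0 < t) :
    ∫ ω, (X ω + Y ω) ⬝ᵥ (P *ᵥ (X ω + Y ω)) ∂μ ≤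
      (1 + t) * ∫ ω, X ω ⬝ᵥ (P *ᵥ X ω) ∂μ + (1 + t⁻¹) * ∫ ω, Y ω ⬝ᵥ (P *ᵥ Y ω) ∂μ := by
  have hXX := (hX.integrable_quad P hX).const_mul (1 + t)
  have hYY := (hY.integrable_quad P hY).const_mul (1 + t⁻¹)
  rw [← integral_const_mul, ← integral_const_mul, ← integral_add hXX hYY]
  exact integral_mono ((hX.add hY).integrable_quad P (hX.add hY)) (hXX.add hYY)
    fun ω => quad_add_le hP (X ω) (Y ω) ht

/-- Young's inequality absorbs the cross term, so the disturbance may be correlated with the state,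
as the estimation error and the feedforward are. -/
lemma exists_integral_quad_le_of_lyapunov {P Y F : Matrix ι ι ℝ} (hP : P.PosSemidef)
    (hY : Y.PosDef) (h : P = Fᵀ * P * F + Y) {X d : ℕ → Ω → ι → ℝ}
    (hX : ∀ k, SquareIntegrable μ (X k)) (hd : ∀ k, SquareIntegrable μ (d k))
    (hrec : ∀ k ω, X (k + 1) ω = F *ᵥ X k ω + d k ω) {c : ℝ}
    (hc : ∀ k, ∫ ω, d k ω ⬝ᵥ (P *ᵥ d k ω) ∂μ ≤ c) :
    ∃ C : ℝ, ∀ k, ∫ ω, X k ω ⬝ᵥ (P *ᵥ X k ω) ∂μ ≤ C := by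
  obtain ⟨γ, hγ1, hγ0, hγ⟩ := exists_contraction hY h
  -- With γ = 1 − 2t, (1 + t)γ ≤ 1 − t, so the energy still contracts up to the constant b.
  set t := (1 - γ) / 2 with ht
  have ht0 : 0 < t := by rw [ht]; linarith
  set b := (1 + t⁻¹) * c with hb
  have hstep : ∀ k, ∫ ω, X (k + 1) ω ⬝ᵥ (P *ᵥ X (k + 1) ω) ∂μ ≤
      (1 - t) * ∫ ω, X k ω ⬝ᵥ (P *ᵥ X k ω) ∂μ + b := by
    intro k
    have h1 := integral_quad_add_le hP ((hX k).mulVec F) (hd k) ht0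
    have h2 : ∫ ω, (F *ᵥ X k ω) ⬝ᵥ (P *ᵥ (F *ᵥ X k ω)) ∂μ ≤
        γ * ∫ ω, X k ω ⬝ᵥ (P *ᵥ X k ω) ∂μ := by
      rw [← integral_const_mul]
      exact integral_mono (((hX k).mulVec F).integrable_quad P ((hX k).mulVec F))
        (((hX k).integrable_quad P (hX k)).const_mul γ) fun ω => hγ (X k ω)
    simp only [hrec]
    have h0 := integral_quad_nonneg (μ := μ) hP (X k)
    have h3 : (1 + t) * γ ≤ 1 - t := by nlinarith
    have h4 : (1 + t⁻¹) * ∫ ω, d k ω ⬝ᵥ (P *ᵥ d k ω) ∂μ ≤ b :=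
      mul_le_mul_of_nonneg_left (hc k) (by positivity)
    calc _ ≤ _ := h1
      _ ≤ (1 + t) * (γ * ∫ ω, X k ω ⬝ᵥ (P *ᵥ X k ω) ∂μ) + b :=
          add_le_add (mul_le_mul_of_nonneg_left h2 (by linarith)) h4
      _ ≤ _ := by
          rw [← mul_assoc]
          exact add_le_add_left (mul_le_mul_of_nonneg_right h3 h0) b
  refine ⟨max (∫ ω, X 0 ω ⬝ᵥ (P *ᵥ X 0 ω) ∂μ) (b / t), fun k => ?_⟩
  induction k with
  | zero => exact le_max_left _ _
  | succ k ih =>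
    set C := max (∫ ω, X 0 ω ⬝ᵥ (P *ᵥ X 0 ω) ∂μ) (b / t)
    have h5 : b ≤ t * C := by
      rw [mul_comm, ← div_le_iff₀ ht0]
      exact le_max_right _ _
    have h6 : (1 - t) * ∫ ω, X k ω ⬝ᵥ (P *ᵥ X k ω) ∂μ ≤ (1 - t) * C :=
      mul_le_mul_of_nonneg_left ih (by rw [ht]; linarith)
    linarith [hstep k]

lemma tendsto_congruence_recursion [DecidableEq ι] {E : Matrix ι ι ℝ}
    (hE : Tendsto (fun k : ℕ => E ^ k) atTop (𝓝 0)) {D : ℕ → Matrix ι ι ℝ}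
    (hD : ∀ k, D (k + 1) = E * D k * Eᵀ) : Tendsto D atTop (𝓝 0) := by
  have hk : ∀ k, D k = E ^ k * D 0 * Eᵀ ^ k := fun k => by
    induction k with
    | zero => simp
    | succ k ih =>
      rw [hD, ih, pow_succ' E, pow_succ Eᵀ]
      simp only [Matrix.mul_assoc]
  have h1 := ((hE.mul_const (D 0)).mul (tendsto_pow_transpose hE))
  rw [zero_mul, zero_mul] at h1
  exact h1.congr fun k => (hk k).symm

end LinearRecursion

/-- The bounded boundary terms vanish after division by n, and the Cesàro means of τ converge to its
limit. -/
lemma tendsto_average_of_telescope {s H τ : ℕ → ℝ} {ρ τ₀ c : ℝ}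
    (hs : ∀ k, s k = H k - H (k + 1) + ρ + τ k) (hH : ∀ k, |H k| ≤ c)
    (hτ : Tendsto τ atTop (𝓝 τ₀)) :
    Tendsto (fun n : ℕ => (1 / (n : ℝ)) * ∑ k ∈ Finset.Icc 1 n, s k) atTop (𝓝 (ρ + τ₀)) := by
  have hsum : ∀ n : ℕ, ∑ k ∈ Finset.Icc 1 n, s k
      = (H 1 - H (n + 1)) + n * ρ + ∑ k ∈ Finset.range n, τ (k + 1) := fun n => by
    induction n with
    | zero => simp
    | succ n ih =>
      rw [Finset.sum_Icc_succ_top (by omega), ih, Finset.sum_range_succ, hs]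
      push_cast
      ring
  have h1 : Tendsto (fun n : ℕ => (n : ℝ)⁻¹ * (H 1 - H (n + 1))) atTop (𝓝 0) := by
    refine (tendsto_inv_atTop_nhds_zero_nat (𝕜 := ℝ)).zero_mul_isBoundedUnder_le ?_
    refine isBoundedUnder_of ⟨c + c, fun n => ?_⟩
    exact (abs_sub _ _).trans (add_le_add (hH _) (hH _))
  have h2 := (hτ.comp (tendsto_add_atTop_nat 1)).cesaro
  have h3 := (h1.add (tendsto_const_nhds (x := ρ))).add h2
  rw [zero_add] at h3
  refine h3.congr' ?_
  filter_upwards [eventually_gt_atTop 0] with n hn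
  have hn' : (n : ℝ) ≠ 0 := by positivity
  rw [hsum, one_div]
  simp only [Function.comp_apply]
  field_simp

/-! ### Block-diagonal matrices -/

section BlockDiagonal

lemma blockDiagonal'_posDef {o : Type*} [Fintype o] [DecidableEq o] {m : o → Type*}
    [∀ i, Fintype (m i)] {M : ∀ i, Matrix (m i) (m i) ℝ} (hM : ∀ i, (M i).PosDef) :
    (blockDiagonal' M).PosDef := by
  have hquad : ∀ z : (Σ i, m i) → ℝ, z ⬝ᵥ (blockDiagonal' M *ᵥ z)
      = ∑ i, (fun a => z ⟨i, a⟩) ⬝ᵥ (M i *ᵥ fun a => z ⟨i, a⟩) := fun z => by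
    simp only [dotProduct, mulVec, Fintype.sum_sigma]
    refine Finset.sum_congr rfl fun i _ => Finset.sum_congr rfl fun a _ => ?_
    congr 1
    rw [Finset.sum_eq_single i]
    · simp [blockDiagonal'_apply_eq]
    · intro j _ hj
      exact Finset.sum_eq_zero fun b _ => by
        rw [blockDiagonal'_apply_ne _ _ _ hj.symm, zero_mul]
    · simp
  refine .of_dotProduct_mulVec_pos ?_ fun z hz => ?_
  · rw [IsHermitian, blockDiagonal'_conjTranspose]
    congr 1
    funext i
    exact (hM i).isHermitian
  · rw [star_trivial, hquad]
    obtain ⟨⟨i, a⟩, hi⟩ := Function.ne_iff.mp hz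
    refine Finset.sum_pos' (fun j _ => (hM j).posSemidef.dotProduct_mulVec_nonneg _)
      ⟨i, Finset.mem_univ i, (hM i).dotProduct_mulVec_pos fun h => hi ?_⟩
    exact congrFun h a

end BlockDiagonal

/-! ### Gains, stability and noise moments of the network -/

namespace Network

variable {N : ℕ} {net : Network N}

namespace Standing

lemma bigC_apply_pos (h : net.Standing) (p : net.X) : 0 < net.bigC p p := h.C_posDef.diag_pos

lemma sens_pos (h : net.Standing) (i : Fin N) : 0 < net.sens i := by
  have hC := h.bigC_apply_pos ⟨i, ⟨0, h.dim_pos i⟩⟩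
  rw [bigC, blockDiagonal'_apply_eq] at hC
  exact ENNReal.toReal_pos (outputSensitivity_ne_zero (h.b_pos i) hC.ne')
    (outputSensitivity_ne_top _ _)

lemma σ_pos (h : net.Standing) (i : Fin N) : 0 < net.σ i :=
  gaussianMechanismStd_pos (h.sens_pos i) (h.ε_pos i)

lemma V_posDef (h : net.Standing) : net.V.PosDef :=
  posDef_diagonal_iff.mpr fun p => pow_pos (h.σ_pos p.1) 2

lemma bigW_posDef (h : net.Standing) : net.bigW.PosDef := blockDiagonal'_posDef h.W_posDef

end Standing

variable (net)

/-- `R + Bᵀ K B`. -/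
def inputWeight (K : Matrix net.X net.X ℝ) : Matrix net.U net.U ℝ :=
  net.R + net.bigBᵀ * K * net.bigB

/-- `A + B L`. -/
def closedLoop (K : Matrix net.X net.X ℝ) : Matrix net.X net.X ℝ :=
  net.bigA + net.bigB * net.L K

/-- The gain `Σ̄ Cᵀ V⁻¹` of the filter. -/
def kalmanGain (S : Matrix net.X net.X ℝ) : Matrix net.X net.X ℝ :=
  net.postCov S * net.bigCᵀ * net.V⁻¹

/-- The matrix of the linear map `r ↦ g(r)`. -/
def refMap (K : Matrix net.X net.X ℝ) : Matrix net.X net.X ℝ :=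
  -((1 - (net.closedLoop K)ᵀ)⁻¹ * net.Q)

/-- The weight `Lᵀ (R + Bᵀ K B) L` with which the estimation error enters the cost. -/
def errorWeight (K : Matrix net.X net.X ℝ) : Matrix net.X net.X ℝ :=
  (net.L K)ᵀ * net.inputWeight K * net.L K

variable {net}

section Control

variable {K : Matrix net.X net.X ℝ}

lemma inputWeight_posDef (h : net.Standing) (hK : net.IsControlRiccati K) :
    (net.inputWeight K).PosDef := PrivateLQG.inputWeight_posDef h.R_posDef hK.1

lemma IsControlRiccati.lyapunov (hK : net.IsControlRiccati K) (h : net.Standing) :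
    K = (net.closedLoop K)ᵀ * K * net.closedLoop K
      + ((net.L K)ᵀ * net.R * net.L K + net.Q) :=
  control_lyapunov h.R_posDef hK.1 hK.2 rfl

lemma stage_weight_posDef (h : net.Standing) (K : Matrix net.X net.X ℝ) :
    ((net.L K)ᵀ * net.R * net.L K + net.Q).PosDef := by
  have h1 := h.R_posDef.posSemidef.conjTranspose_mul_mul_same (net.L K)
  rw [conjTranspose_eq_transpose_of_trivial] at h1
  exact PosDef.posSemidef_add h1 h.Q_posDef

/-- K − Q is a sum of two congruences in the Lyapunov equation. This yields K ≻ 0 and later allows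
−(K − Q) to be dropped from the error weight. -/
lemma IsControlRiccati.sub_posDef (hK : net.IsControlRiccati K) (h : net.Standing) :
    (K - net.Q).PosSemidef := by
  have h1 := hK.1.conjTranspose_mul_mul_same (net.closedLoop K)
  have h2 := h.R_posDef.posSemidef.conjTranspose_mul_mul_same (net.L K)
  rw [conjTranspose_eq_transpose_of_trivial] at h1 h2
  have h3 := h1.add h2
  convert h3 using 1
  nth_rewrite 1 [hK.lyapunov h]
  abel

lemma IsControlRiccati.posDef (hK : net.IsControlRiccati K) (h : net.Standing) : K.PosDef := by
  simpa using PosDef.posSemidef_add (hK.sub_posDef h) h.Q_posDef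

lemma closedLoop_pow_tendsto (h : net.Standing) (hK : net.IsControlRiccati K) :
    Tendsto (fun k : ℕ => net.closedLoop K ^ k) atTop (𝓝 0) :=
  tendsto_pow_zero_of_lyapunov (hK.posDef h) (stage_weight_posDef h K) (hK.lyapunov h)

lemma closedLoop_transpose (h : net.Standing) (hK : net.IsControlRiccati K) :
    (net.closedLoop K)ᵀ = net.bigAᵀ *
      (1 - K * net.bigB * (net.R + net.bigBᵀ * K * net.bigB)⁻¹ * net.bigBᵀ) := by
  have hSt := transpose_eq_of_posSemidef (inputWeight_posDef h hK).posSemidef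
  rw [inputWeight] at hSt
  rw [closedLoop, L]
  generalize net.R + net.bigBᵀ * K * net.bigB = T at hSt ⊢
  simp only [transpose_add, transpose_neg, transpose_mul, transpose_nonsing_inv, hSt,
    transpose_eq_of_posSemidef hK.1, transpose_transpose, Matrix.mul_one,
    Matrix.mul_assoc, sub_eq_add_neg, Matrix.mul_add, Matrix.mul_neg]

lemma g_eq_refMap (h : net.Standing) (hK : net.IsControlRiccati K) (r : net.X → ℝ) :
    net.g K r = net.refMap K *ᵥ r := by
  rw [g, refMap, ← closedLoop_transpose h hK, mulVec_neg, mulVec_mulVec, neg_mulVec]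

/-- `g` is defined through a matrix inverse, so it solves its equation only once 1 − (A + BL)ᵀ is
known to be invertible; stability of A + BL ensures this. -/
lemma g_fixed_point (h : net.Standing) (hK : net.IsControlRiccati K) (r : net.X → ℝ) :
    net.g K r = (net.closedLoop K)ᵀ *ᵥ net.g K r - net.Q *ᵥ r := by
  have hdet := isUnit_det_one_sub_of_tendsto_pow
    (tendsto_pow_transpose (closedLoop_pow_tendsto h hK))
  have h1 : (1 - (net.closedLoop K)ᵀ) *ᵥ net.g K r = -(net.Q *ᵥ r) := by
    rw [g_eq_refMap h hK, refMap, mulVec_mulVec, Matrix.mul_neg, ← Matrix.mul_assoc,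
      mul_nonsing_inv _ hdet, Matrix.one_mul, neg_mulVec]
  rw [sub_mulVec, one_mulVec] at h1
  rw [sub_eq_iff_eq_add] at h1
  nth_rewrite 1 [h1]
  abel

lemma g_add (h : net.Standing) (hK : net.IsControlRiccati K) (r r' : net.X → ℝ) :
    net.g K (r + r') = net.g K r + net.g K r' := by
  simp only [g_eq_refMap h hK, mulVec_add]

lemma errorWeight_eq (h : net.Standing) (hK : net.IsControlRiccati K) :
    net.errorWeight K = net.bigAᵀ * K * net.bigA + net.Q - K :=
  gain_weight_eq h.R_posDef hK.1 hK.2 rfl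

lemma refWeight_posSemidef (h : net.Standing) (hK : net.IsControlRiccati K) :
    (net.bigB * (net.inputWeight K)⁻¹ * net.bigBᵀ).PosSemidef := by
  have h1 := (inputWeight_posDef h hK).inv.posSemidef.mul_mul_conjTranspose_same net.bigB
  rwa [conjTranspose_eq_transpose_of_trivial] at h1

end Control

section Filter

variable {S : Matrix net.X net.X ℝ}

lemma IsFilterRiccati.postCov_eq (hS : net.IsFilterRiccati S) (h : net.Standing) :
    net.postCov S = (1 - net.kalmanGain S * net.bigC)
        * (net.bigA * net.postCov S * net.bigAᵀ + net.bigW)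
        * (1 - net.kalmanGain S * net.bigC)ᵀ
      + net.kalmanGain S * net.V * (net.kalmanGain S)ᵀ :=
  estimate_lyapunov h.V_posDef hS.1 rfl rfl hS.2

lemma IsFilterRiccati.postCov_lyapunov (hS : net.IsFilterRiccati S) (h : net.Standing) :
    net.postCov S = ((1 - net.kalmanGain S * net.bigC) * net.bigA) * net.postCov S
        * ((1 - net.kalmanGain S * net.bigC) * net.bigA)ᵀ
      + ((1 - net.kalmanGain S * net.bigC) * net.bigW * (1 - net.kalmanGain S * net.bigC)ᵀ
        + net.kalmanGain S * net.V * (net.kalmanGain S)ᵀ) := by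
  nth_rewrite 1 [hS.postCov_eq h]
  rw [Matrix.mul_add, Matrix.add_mul, transpose_mul]
  simp only [Matrix.mul_assoc, add_assoc]

lemma IsFilterRiccati.postCov_posSemidef (hS : net.IsFilterRiccati S) (h : net.Standing) :
    (net.postCov S).PosSemidef := by
  have h1 := hS.1.mul_mul_conjTranspose_same (1 - net.kalmanGain S * net.bigC)
  have h2 := h.V_posDef.posSemidef.mul_mul_conjTranspose_same (net.kalmanGain S)
  rw [conjTranspose_eq_transpose_of_trivial] at h1 h2
  have e : net.postCov S = _ :=
    joseph_form (G := net.kalmanGain S) h.V_posDef hS.1 rfl rfl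
  rw [e]
  exact h1.add h2

lemma IsFilterRiccati.postCov_posDef (hS : net.IsFilterRiccati S) (h : net.Standing) :
    (net.postCov S).PosDef := by
  have h1 := (hS.postCov_posSemidef h).mul_mul_conjTranspose_same
    ((1 - net.kalmanGain S * net.bigC) * net.bigA)
  rw [conjTranspose_eq_transpose_of_trivial] at h1
  rw [hS.postCov_lyapunov h]
  exact PosDef.posSemidef_add h1 (updated_noise_posDef h.V_posDef h.bigW_posDef _)

lemma error_pow_tendsto (h : net.Standing) (hS : net.IsFilterRiccati S) :
    Tendsto (fun k : ℕ => ((1 - net.kalmanGain S * net.bigC) * net.bigA) ^ k) atTop (𝓝 0) := by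
  have hP := hS.postCov_posDef h
  have hY := updated_noise_posDef (C := net.bigC) h.V_posDef h.bigW_posDef (net.kalmanGain S)
  have hlyap := hS.postCov_lyapunov h
  generalize (1 - net.kalmanGain S * net.bigC) * net.bigA = E at hlyap ⊢
  -- The filter equation is the dual one, P = EPEᵀ + Y, hence the transpose.
  have h1 := tendsto_pow_zero_of_lyapunov (F := Eᵀ) hP hY (by rwa [transpose_transpose])
  have h2 := tendsto_pow_transpose h1
  rwa [transpose_transpose] at h2

end Filter

section Signals

variable {Ω : Type*} [MeasurableSpace Ω] {μ : Measure Ω} {ξ : net.Noise Ω}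

namespace Noise.IsModel

lemma squareIntegrable (hξ : ξ.IsModel μ) (s : Source) : SquareIntegrable μ (ξ.signal s) := by
  cases s with
  | init => exact hξ.init_memLp
  | ref => exact memLp_of_hasLaw_gaussian hξ.ref_law
  | proc k =>
    rintro ⟨i, a⟩
    exact memLp_of_hasLaw_gaussian (X := fun ω a => ξ.w k ω ⟨i, a⟩) (hξ.proc_law k i) a
  | priv k => exact memLp_of_hasLaw_gaussian (hξ.priv_law k)

lemma integral_eq_zero (hξ : ξ.IsModel μ) {s : Source} (hs : s ≠ .init) (p : net.X) :
    ∫ ω, ξ.signal s ω p ∂μ = 0 := by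
  cases s with
  | init => exact absurd rfl hs
  | ref => exact integral_of_hasLaw_gaussian hξ.ref_law p
  | proc k =>
    obtain ⟨i, a⟩ := p
    exact integral_of_hasLaw_gaussian (X := fun ω a => ξ.w k ω ⟨i, a⟩) (hξ.proc_law k i) a
  | priv k => exact integral_of_hasLaw_gaussian (hξ.priv_law k) p

/-- Covariance and E[XYᵀ] agree as soon as one factor is centred; x(0) need not be, which is why t
must not be `init`. -/
lemma orthogonal [IsProbabilityMeasure μ] (hξ : ξ.IsModel μ) {s t : Source} (hst : s ≠ t)
    (ht : t ≠ .init) : Orthogonal μ (ξ.signal s) (ξ.signal t) := by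
  refine ⟨hξ.squareIntegrable s, hξ.squareIntegrable t, ?_⟩
  ext p q
  have h := hξ.uncorr s t hst p q
  rw [covariance_eq_sub (hξ.squareIntegrable s p) (hξ.squareIntegrable t q),
    hξ.integral_eq_zero ht q, mul_zero, sub_zero] at h
  exact h

lemma crossMoment_ref (hξ : ξ.IsModel μ) (h : net.Standing) :
    crossMoment μ ξ.wbar ξ.wbar = net.Wbar := by
  ext p q
  -- `Wbar` is `V` by definition, since σ̄ = σ.
  exact covariance_of_hasLaw_gaussian h.V_posDef.posSemidef hξ.ref_law p q

lemma crossMoment_priv (hξ : ξ.IsModel μ) (h : net.Standing) (k : ℕ) :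
    crossMoment μ (ξ.v k) (ξ.v k) = net.V := by
  ext p q
  exact covariance_of_hasLaw_gaussian h.V_posDef.posSemidef (hξ.priv_law k) p q

lemma crossMoment_proc [IsProbabilityMeasure μ] (hξ : ξ.IsModel μ) (h : net.Standing) (k : ℕ) :
    crossMoment μ (ξ.w k) (ξ.w k) = net.bigW := by
  ext p q
  -- Only the law of each agent's block is given; the off-diagonal blocks vanish by `proc_uncorr`.
  by_cases hpq : p.1 = q.1
  · obtain ⟨i, a⟩ := p
    obtain ⟨j, b⟩ := q
    obtain rfl : i = j := hpq
    rw [bigW, blockDiagonal'_apply_eq]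
    exact covariance_of_hasLaw_gaussian (X := fun ω a => ξ.w k ω ⟨i, a⟩)
      (h.W_posDef i).posSemidef (hξ.proc_law k i) a b
  · have hc := hξ.proc_uncorr k p q hpq
    have hm := hξ.integral_eq_zero (s := .proc k) (by simp) q
    have hsq := hξ.squareIntegrable (.proc k)
    rw [Noise.signal] at hm hsq
    rw [covariance_eq_sub (hsq p) (hsq q), hm, mul_zero, sub_zero] at hc
    obtain ⟨i, a⟩ := p
    obtain ⟨j, b⟩ := q
    rw [bigW, blockDiagonal'_apply_ne _ _ _ hpq]
    exact hc

end Noise.IsModel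

end Signals

end Network

/-! ### Closed-loop recursions, orthogonality and the error covariance -/

namespace Network

variable {N : ℕ} {net : Network N} {Ω : Type*} [MeasurableSpace Ω] {μ : Measure Ω}
  {ξ : net.Noise Ω} {K S : Matrix net.X net.X ℝ}

variable (net μ ξ K S) in
/-- The estimation error `x(k) - x̂(k)`. -/
def estError (k : ℕ) (ω : Ω) : net.X → ℝ :=
  (net.loop μ ξ K S k ω).1 - (net.loop μ ξ K S k ω).2

variable (net ξ K) in
/-- The feedforward vector `g(x̃)`. -/
def feedforward (ω : Ω) : net.X → ℝ := net.g K (net.xtilde ξ ω)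

lemma control_eq (k : ℕ) (ω : Ω) :
    net.control ξ K ω (net.loop μ ξ K S k ω).2
      = net.L K *ᵥ ((net.loop μ ξ K S k ω).1 - net.estError μ ξ K S k ω)
        + net.M K *ᵥ net.feedforward ξ K ω := by
  rw [estError, sub_sub_cancel]
  rfl

lemma loop_succ_fst (k : ℕ) (ω : Ω) :
    (net.loop μ ξ K S (k + 1) ω).1 = net.bigA *ᵥ (net.loop μ ξ K S k ω).1
      + net.bigB *ᵥ net.control ξ K ω (net.loop μ ξ K S k ω).2 + ξ.w k ω := rfl

/-- The plant and the predictor receive the same input, so it cancels: the error dynamics are free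
of the control and of the reference. -/
lemma estError_succ (k : ℕ) (ω : Ω) :
    net.estError μ ξ K S (k + 1) ω = (1 - net.kalmanGain S * net.bigC) *ᵥ
        (net.bigA *ᵥ net.estError μ ξ K S k ω + ξ.w k ω)
      - net.kalmanGain S *ᵥ ξ.v (k + 1) ω := by
  have h2 : (net.loop μ ξ K S (k + 1) ω).2 = net.bigA *ᵥ (net.loop μ ξ K S k ω).2
      + net.bigB *ᵥ net.control ξ K ω (net.loop μ ξ K S k ω).2
      + net.kalmanGain S *ᵥ (net.bigC *ᵥ (net.loop μ ξ K S (k + 1) ω).1 + ξ.v (k + 1) ω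
        - net.bigC *ᵥ (net.bigA *ᵥ (net.loop μ ξ K S k ω).2
          + net.bigB *ᵥ net.control ξ K ω (net.loop μ ξ K S k ω).2)) := rfl
  rw [estError, h2, loop_succ_fst, estError]
  simp only [mulVec_add, mulVec_sub, sub_mulVec, one_mulVec, ← mulVec_mulVec]
  abel

lemma loop_succ_fst_closedLoop (k : ℕ) (ω : Ω) :
    (net.loop μ ξ K S (k + 1) ω).1 = net.closedLoop K *ᵥ (net.loop μ ξ K S k ω).1
      + (net.bigB *ᵥ (net.M K *ᵥ net.feedforward ξ K ω)
        + (ξ.w k ω + -(net.bigB * net.L K) *ᵥ net.estError μ ξ K S k ω)) := by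
  rw [loop_succ_fst, control_eq, closedLoop]
  simp only [mulVec_add, mulVec_sub, add_mulVec, neg_mulVec, mulVec_mulVec]
  abel

omit [MeasurableSpace Ω] in
lemma feedforward_eq (h : net.Standing) (hK : net.IsControlRiccati K) (ω : Ω) :
    net.feedforward ξ K ω = net.g K net.xbar + net.refMap K *ᵥ ξ.wbar ω := by
  rw [feedforward, xtilde, g_add h hK, g_eq_refMap h hK (ξ.wbar ω)]

/-- The noise sources that have not yet acted on the state and the estimate at time `k`. -/
def IsFuture (k : ℕ) (t : Source) : Prop :=
  (∃ j, k ≤ j ∧ t = .proc j) ∨ ∃ j, k < j ∧ t = .priv j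

lemma IsFuture.of_succ {k : ℕ} {t : Source} (h : IsFuture (k + 1) t) : IsFuture k t := by
  rcases h with ⟨j, hj, rfl⟩ | ⟨j, hj, rfl⟩
  · exact .inl ⟨j, by omega, rfl⟩
  · exact .inr ⟨j, by omega, rfl⟩

lemma IsFuture.ne_init {k : ℕ} {t : Source} (h : IsFuture k t) : t ≠ .init := by
  rcases h with ⟨j, -, rfl⟩ | ⟨j, -, rfl⟩ <;> simp

lemma IsFuture.ne_ref {k : ℕ} {t : Source} (h : IsFuture k t) : t ≠ .ref := by
  rcases h with ⟨j, -, rfl⟩ | ⟨j, -, rfl⟩ <;> simp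

lemma IsFuture.ne_proc {k : ℕ} {t : Source} (h : IsFuture (k + 1) t) : t ≠ .proc k := by
  rcases h with ⟨j, hj, rfl⟩ | ⟨j, -, rfl⟩
  · simp only [ne_eq, Source.proc.injEq]; omega
  · simp

lemma IsFuture.ne_priv {k : ℕ} {t : Source} (h : IsFuture (k + 1) t) : t ≠ .priv (k + 1) := by
  rcases h with ⟨j, -, rfl⟩ | ⟨j, hj, rfl⟩
  · simp
  · simp only [ne_eq, Source.priv.injEq]; omega

section Orthogonality

variable [IsProbabilityMeasure μ]

lemma feedforward_orthogonal (h : net.Standing) (hξ : ξ.IsModel μ) (hK : net.IsControlRiccati K)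
    {t : Source} (ht : t ≠ .init) (ht' : t ≠ .ref) :
    Orthogonal μ (net.feedforward ξ K) (ξ.signal t) := by
  have e : net.feedforward ξ K = fun ω => net.g K net.xbar + net.refMap K *ᵥ ξ.signal .ref ω :=
    funext fun ω => feedforward_eq h hK ω
  rw [e]
  exact (Orthogonal.const_left _ (hξ.squareIntegrable t) (hξ.integral_eq_zero ht)).add_left
    ((hξ.orthogonal ht'.symm ht).mulVec_left _)

omit [IsProbabilityMeasure μ] in
lemma control_orthogonal {t : Source} {k : ℕ}
    (hg : Orthogonal μ (net.feedforward ξ K) (ξ.signal t))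
    (hx : Orthogonal μ (fun ω => (net.loop μ ξ K S k ω).2) (ξ.signal t)) :
    Orthogonal μ (fun ω => net.control ξ K ω (net.loop μ ξ K S k ω).2) (ξ.signal t) :=
  (hx.mulVec_left (net.L K)).add_left (hg.mulVec_left (net.M K))

/-- The pair (x(k), x̂(k)) is affine in x(0), w̄, w(0), …, w(k−1), v(1), …, v(k). Orthogonality to
later sources therefore passes through the recursion, the constants being handled by the zero means.
-/
lemma loop_orthogonal (h : net.Standing) (hξ : ξ.IsModel μ) (hK : net.IsControlRiccati K)
    (k : ℕ) : ∀ t, IsFuture k t →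
      Orthogonal μ (fun ω => (net.loop μ ξ K S k ω).1) (ξ.signal t) ∧
      Orthogonal μ (fun ω => (net.loop μ ξ K S k ω).2) (ξ.signal t) := by
  induction k with
  | zero =>
    intro t ht
    exact ⟨hξ.orthogonal (s := .init) ht.ne_init.symm ht.ne_init,
      Orthogonal.const_left _ (hξ.squareIntegrable t) (hξ.integral_eq_zero ht.ne_init)⟩
  | succ k ih =>
    intro t ht
    obtain ⟨ih1, ih2⟩ := ih t ht.of_succ
    have hu := (control_orthogonal (feedforward_orthogonal h hξ hK ht.ne_init ht.ne_ref)
      ih2).mulVec_left net.bigB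
    have h1 : Orthogonal μ (fun ω => (net.loop μ ξ K S (k + 1) ω).1) (ξ.signal t) :=
      ((ih1.mulVec_left net.bigA).add_left hu).add_left
        (hξ.orthogonal (s := .proc k) ht.ne_proc.symm ht.ne_init)
    have hp := (ih2.mulVec_left net.bigA).add_left hu
    exact ⟨h1, hp.add_left ((((h1.mulVec_left net.bigC).add_left
      (hξ.orthogonal (s := .priv (k + 1)) ht.ne_priv.symm ht.ne_init)).sub_left
        (hp.mulVec_left net.bigC)).mulVec_left (net.kalmanGain S))⟩

lemma state_orthogonal (h : net.Standing) (hξ : ξ.IsModel μ) (hK : net.IsControlRiccati K)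
    (k : ℕ) : Orthogonal μ (fun ω => (net.loop μ ξ K S k ω).1) (ξ.w k) :=
  (loop_orthogonal h hξ hK k (.proc k) (.inl ⟨k, le_rfl, rfl⟩)).1

lemma estError_orthogonal (h : net.Standing) (hξ : ξ.IsModel μ) (hK : net.IsControlRiccati K)
    {k : ℕ} {t : Source} (ht : IsFuture k t) :
    Orthogonal μ (net.estError μ ξ K S k) (ξ.signal t) :=
  (loop_orthogonal h hξ hK k t ht).1.sub_left (loop_orthogonal h hξ hK k t ht).2

lemma drift_orthogonal (h : net.Standing) (hξ : ξ.IsModel μ) (hK : net.IsControlRiccati K)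
    (k : ℕ) : Orthogonal μ (fun ω => net.bigA *ᵥ (net.loop μ ξ K S k ω).1
      + net.bigB *ᵥ net.control ξ K ω (net.loop μ ξ K S k ω).2) (ξ.w k) :=
  ((state_orthogonal h hξ hK k).mulVec_left net.bigA).add_left
    ((control_orthogonal (t := .proc k) (feedforward_orthogonal h hξ hK (by simp) (by simp))
      (loop_orthogonal h hξ hK k (.proc k) (.inl ⟨k, le_rfl, rfl⟩)).2).mulVec_left net.bigB)

end Orthogonality

section Covariance

variable [IsProbabilityMeasure μ]

variable (net μ ξ K S) in
/-- The second moment matrix of the estimation error. -/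
def errCov (k : ℕ) : Matrix net.X net.X ℝ :=
  crossMoment μ (net.estError μ ξ K S k) (net.estError μ ξ K S k)

/-- A e(k), w(k) and v(k+1) are pairwise orthogonal, so no cross moments survive. -/
lemma errCov_succ (h : net.Standing) (hξ : ξ.IsModel μ) (hK : net.IsControlRiccati K) (k : ℕ) :
    net.errCov μ ξ K S (k + 1) = (1 - net.kalmanGain S * net.bigC)
        * (net.bigA * net.errCov μ ξ K S k * net.bigAᵀ + net.bigW)
        * (1 - net.kalmanGain S * net.bigC)ᵀ
      + net.kalmanGain S * net.V * (net.kalmanGain S)ᵀ := by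
  have hw : Orthogonal μ (fun ω => net.bigA *ᵥ net.estError μ ξ K S k ω) (ξ.w k) :=
    (estError_orthogonal h hξ hK (t := .proc k) (.inl ⟨k, le_rfl, rfl⟩)).mulVec_left net.bigA
  have hev : Orthogonal μ (fun ω => net.bigA *ᵥ net.estError μ ξ K S k ω) (ξ.v (k + 1)) :=
    (estError_orthogonal h hξ hK (t := .priv (k + 1))
      (.inr ⟨k + 1, by omega, rfl⟩)).mulVec_left net.bigA
  have hwv : Orthogonal μ (ξ.w k) (ξ.v (k + 1)) :=
    hξ.orthogonal (s := .proc k) (t := .priv (k + 1)) (by simp) (by simp)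
  have he : SquareIntegrable μ (net.estError μ ξ K S k) :=
    (estError_orthogonal h hξ hK (t := .proc k) (.inl ⟨k, le_rfl, rfl⟩)).left
  have hsum := hw.left.add hw.right
  have hv := hwv.right
  have hfin := ((hev.add_left hwv).mulVec_left
    (1 - net.kalmanGain S * net.bigC)).mulVec_right (net.kalmanGain S)
  rw [errCov, show net.estError μ ξ K S (k + 1) = _ from funext fun ω => estError_succ k ω,
    hfin.crossMoment_sub_self,
    crossMoment_mulVec_left _ hsum (hsum.mulVec _), crossMoment_mulVec_right _ hsum hsum,
    crossMoment_mulVec_left _ hv (hv.mulVec _), crossMoment_mulVec_right _ hv hv,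
    hw.crossMoment_add_self, crossMoment_mulVec_left _ he (he.mulVec _),
    crossMoment_mulVec_right _ he he, hξ.crossMoment_proc h, hξ.crossMoment_priv h, errCov]
  simp only [Matrix.mul_assoc]

/-- Σ̄ is a fixed point of the same affine recursion, so the difference evolves by D ↦ EDEᵀ with E
stable, whatever the initial covariance. -/
lemma errCov_tendsto (h : net.Standing) (hξ : ξ.IsModel μ) (hK : net.IsControlRiccati K)
    (hS : net.IsFilterRiccati S) :
    Tendsto (net.errCov μ ξ K S) atTop (𝓝 (net.postCov S)) := by
  have hD := tendsto_congruence_recursion (error_pow_tendsto h hS)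
    (D := fun k => net.errCov μ ξ K S k - net.postCov S) fun k => by
      have h1 := errCov_succ (S := S) h hξ hK k
      have h2 := hS.postCov_eq h
      rw [h1]
      nth_rewrite 1 [h2]
      rw [transpose_mul]
      simp only [Matrix.mul_add, Matrix.add_mul, Matrix.mul_sub, Matrix.sub_mul, Matrix.mul_assoc]
      abel
  simpa using hD.add_const (net.postCov S)

lemma trace_mul_errCov_tendsto (h : net.Standing) (hξ : ξ.IsModel μ)
    (hK : net.IsControlRiccati K) (hS : net.IsFilterRiccati S) (T : Matrix net.X net.X ℝ) :
    Tendsto (fun k => (T * net.errCov μ ξ K S k).trace) atTop (𝓝 (T * net.postCov S).trace) :=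
  (((continuous_const.matrix_mul continuous_id).matrix_trace).tendsto (net.postCov S)).comp
    (errCov_tendsto h hξ hK hS)

end Covariance

end Network

/-! ### Existence and value of the private cost -/

namespace Network

variable {N : ℕ} {net : Network N} {Ω : Type*} [MeasurableSpace Ω] {μ : Measure Ω}
  {ξ : net.Noise Ω} {K S : Matrix net.X net.X ℝ}

section Cost

variable (net μ ξ K S) in
/-- The value function of the tracking problem along the closed loop. -/
def valueAlong (k : ℕ) (ω : Ω) : ℝ :=
  (net.loop μ ξ K S k ω).1 ⬝ᵥ (K *ᵥ (net.loop μ ξ K S k ω).1)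
    + 2 * (net.feedforward ξ K ω ⬝ᵥ (net.loop μ ξ K S k ω).1)

variable (net μ ξ K S) in
/-- The process noise terms in the Bellman equation. -/
def noiseTerm (k : ℕ) (ω : Ω) : ℝ :=
  ξ.w k ω ⬝ᵥ (K *ᵥ ξ.w k ω)
    + 2 * ((net.bigA *ᵥ (net.loop μ ξ K S k ω).1
      + net.bigB *ᵥ net.control ξ K ω (net.loop μ ξ K S k ω).2) ⬝ᵥ (K *ᵥ ξ.w k ω))
    + 2 * (net.feedforward ξ K ω ⬝ᵥ ξ.w k ω)

variable (net ξ K) in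
/-- The part of the stage cost that depends only on the private reference. -/
def refTerm (ω : Ω) : ℝ :=
  net.xtilde ξ ω ⬝ᵥ (net.Q *ᵥ net.xtilde ξ ω)
    - net.feedforward ξ K ω ⬝ᵥ
      ((net.bigB * (net.inputWeight K)⁻¹ * net.bigBᵀ) *ᵥ net.feedforward ξ K ω)

lemma stageCost_eq (h : net.Standing) (hK : net.IsControlRiccati K) (k : ℕ) (ω : Ω) :
    net.stageCost μ ξ K S k ω = net.valueAlong μ ξ K S k ω - net.valueAlong μ ξ K S (k + 1) ω
      + net.noiseTerm μ ξ K S k ω + net.refTerm ξ K ω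
      + net.estError μ ξ K S k ω ⬝ᵥ (net.errorWeight K *ᵥ net.estError μ ξ K S k ω) := by
  have h1 := tracking_bellman h.R_posDef hK.1
    (transpose_eq_of_posSemidef h.Q_posDef.posSemidef) hK.2 (L := net.L K) (M := net.M K) rfl rfl
    (g_fixed_point h hK (net.xtilde ξ ω)) (net.loop μ ξ K S k ω).1 (net.estError μ ξ K S k ω)
    (ξ.w k ω) (control_eq k ω) (loop_succ_fst k ω)
  refine (show net.stageCost μ ξ K S k ω = _ from h1).trans ?_
  unfold valueAlong noiseTerm refTerm errorWeight inputWeight feedforward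
  ring

variable [IsProbabilityMeasure μ]

lemma state_squareIntegrable (h : net.Standing) (hξ : ξ.IsModel μ)
    (hK : net.IsControlRiccati K) (k : ℕ) :
    SquareIntegrable μ (fun ω => (net.loop μ ξ K S k ω).1) :=
  (state_orthogonal h hξ hK k).left

lemma estError_squareIntegrable (h : net.Standing) (hξ : ξ.IsModel μ)
    (hK : net.IsControlRiccati K) (k : ℕ) : SquareIntegrable μ (net.estError μ ξ K S k) :=
  (estError_orthogonal h hξ hK (t := .proc k) (.inl ⟨k, le_rfl, rfl⟩)).left

lemma feedforward_squareIntegrable (h : net.Standing) (hξ : ξ.IsModel μ)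
    (hK : net.IsControlRiccati K) : SquareIntegrable μ (net.feedforward ξ K) :=
  (feedforward_orthogonal h hξ hK (t := .proc 0) (by simp) (by simp)).left

lemma xtilde_squareIntegrable (hξ : ξ.IsModel μ) : SquareIntegrable μ (net.xtilde ξ) :=
  (SquareIntegrable.const net.xbar).add (hξ.squareIntegrable .ref)

lemma valueAlong_integrable (h : net.Standing) (hξ : ξ.IsModel μ)
    (hK : net.IsControlRiccati K) (k : ℕ) : Integrable (net.valueAlong μ ξ K S k) μ := by
  have hx := state_squareIntegrable (S := S) h hξ hK k
  exact (hx.integrable_quad K hx).add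
    (((feedforward_squareIntegrable h hξ hK).integrable_dotProduct hx).const_mul 2)

lemma noiseTerm_integrable_and_integral (h : net.Standing) (hξ : ξ.IsModel μ)
    (hK : net.IsControlRiccati K) (k : ℕ) : Integrable (net.noiseTerm μ ξ K S k) μ ∧
      ∫ ω, net.noiseTerm μ ξ K S k ω ∂μ = (K * net.bigW).trace := by
  have hw : SquareIntegrable μ (ξ.w k) := hξ.squareIntegrable (.proc k)
  have hd := drift_orthogonal (S := S) h hξ hK k
  have hg : Orthogonal μ (net.feedforward ξ K) (ξ.w k) :=
    feedforward_orthogonal h hξ hK (t := .proc k) (by simp) (by simp)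
  have i1 := hw.integrable_quad K hw
  have i2 := (hd.left.integrable_quad K hw).const_mul 2
  have i3 := (hg.left.integrable_dotProduct hw).const_mul 2
  refine ⟨(i1.add i2).add i3, ?_⟩
  refine (integral_add (i1.add i2) i3).trans ?_
  refine (congrArg (· + _) (integral_add i1 i2)).trans ?_
  rw [integral_const_mul, integral_const_mul,
    hd.integral_quad_eq_zero, hg.integral_dotProduct_eq_zero, integral_quad hw K hw,
    hξ.crossMoment_proc h]
  ring

lemma refTerm_integrable (h : net.Standing) (hξ : ξ.IsModel μ) (hK : net.IsControlRiccati K) :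
    Integrable (net.refTerm ξ K) μ := by
  have hr := xtilde_squareIntegrable hξ
  have hg := feedforward_squareIntegrable h hξ hK
  exact (hr.integrable_quad _ hr).sub (hg.integrable_quad _ hg)

/-- Both x̃ and g(x̃) are a constant plus a linear image of w̄, so mean and fluctuation separate.
The fluctuation of g(x̃) enters with a minus sign and is discarded; that is the only inequality. -/
lemma integral_refTerm_le (h : net.Standing) (hξ : ξ.IsModel μ) (hK : net.IsControlRiccati K) :
    ∫ ω, net.refTerm ξ K ω ∂μ ≤ net.xbar ⬝ᵥ (net.Q *ᵥ net.xbar) + (net.Q * net.Wbar).trace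
      - net.g K net.xbar ⬝ᵥ
        ((net.bigB * (net.inputWeight K)⁻¹ * net.bigBᵀ) *ᵥ net.g K net.xbar) := by
  have hr := xtilde_squareIntegrable hξ
  have hg := feedforward_squareIntegrable h hξ hK
  have hw : SquareIntegrable μ ξ.wbar := hξ.squareIntegrable .ref
  have hquad : ∀ (T : Matrix net.X net.X ℝ) (c : net.X → ℝ) (G : Matrix net.X net.X ℝ),
      ∫ ω, (c + G *ᵥ ξ.wbar ω) ⬝ᵥ (T *ᵥ (c + G *ᵥ ξ.wbar ω)) ∂μ
        = c ⬝ᵥ (T *ᵥ c) + ∫ ω, (G *ᵥ ξ.wbar ω) ⬝ᵥ (T *ᵥ (G *ᵥ ξ.wbar ω)) ∂μ := by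
    intro T c G
    have hc : Orthogonal μ (fun _ : Ω => c) (fun ω => G *ᵥ ξ.wbar ω) :=
      (Orthogonal.const_left c hw (hξ.integral_eq_zero (s := .ref) (by simp))).mulVec_right G
    have hs := hc.left.add hc.right
    rw [integral_quad hs T hs, hc.crossMoment_add_self, Matrix.mul_add, trace_add,
      ← integral_quad hc.left T hc.left, ← integral_quad hc.right T hc.right]
    simp
  have hQ : ∫ ω, net.xtilde ξ ω ⬝ᵥ (net.Q *ᵥ net.xtilde ξ ω) ∂μ
      = net.xbar ⬝ᵥ (net.Q *ᵥ net.xbar) + (net.Q * net.Wbar).trace := by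
    have h1 := hquad net.Q net.xbar 1
    simp only [one_mulVec] at h1
    rw [integral_quad hw net.Q hw, hξ.crossMoment_ref h] at h1
    exact h1
  have hN : net.g K net.xbar ⬝ᵥ
        ((net.bigB * (net.inputWeight K)⁻¹ * net.bigBᵀ) *ᵥ net.g K net.xbar)
      ≤ ∫ ω, net.feedforward ξ K ω ⬝ᵥ
        ((net.bigB * (net.inputWeight K)⁻¹ * net.bigBᵀ) *ᵥ net.feedforward ξ K ω) ∂μ := by
    simp only [feedforward_eq h hK]
    rw [hquad]
    exact le_add_of_nonneg_right (integral_quad_nonneg (refWeight_posSemidef h hK) _)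
  unfold refTerm
  rw [integral_sub (hr.integrable_quad _ hr) (hg.integrable_quad _ hg), hQ]
  linarith

lemma stageCost_integrable (h : net.Standing) (hξ : ξ.IsModel μ) (hK : net.IsControlRiccati K)
    (k : ℕ) : Integrable (net.stageCost μ ξ K S k) μ := by
  have he := estError_squareIntegrable (S := S) h hξ hK k
  have h1 := ((((valueAlong_integrable (S := S) h hξ hK k).sub
    (valueAlong_integrable (S := S) h hξ hK (k + 1))).add
    (noiseTerm_integrable_and_integral (S := S) h hξ hK k).1).add
    (refTerm_integrable h hξ hK)).add (he.integrable_quad (net.errorWeight K) he)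
  exact h1.congr (.of_forall fun ω => (stageCost_eq h hK k ω).symm)

lemma integral_stageCost (h : net.Standing) (hξ : ξ.IsModel μ) (hK : net.IsControlRiccati K)
    (k : ℕ) : ∫ ω, net.stageCost μ ξ K S k ω ∂μ
      = (∫ ω, net.valueAlong μ ξ K S k ω ∂μ) - (∫ ω, net.valueAlong μ ξ K S (k + 1) ω ∂μ)
        + ((K * net.bigW).trace + ∫ ω, net.refTerm ξ K ω ∂μ)
        + (net.errorWeight K * net.errCov μ ξ K S k).trace := by
  have he := estError_squareIntegrable (S := S) h hξ hK k
  have i1 := valueAlong_integrable (S := S) h hξ hK k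
  have i2 := valueAlong_integrable (S := S) h hξ hK (k + 1)
  obtain ⟨i3, e3⟩ := noiseTerm_integrable_and_integral (S := S) h hξ hK k
  have i4 := refTerm_integrable h hξ hK
  simp only [stageCost_eq h hK]
  refine (integral_add (((i1.sub i2).add i3).add i4) (he.integrable_quad _ he)).trans ?_
  rw [integral_add' ((i1.sub i2).add i3) i4, integral_add' (i1.sub i2) i3, integral_sub' i1 i2,
    e3, integral_quad he _ he, errCov]
  ring

lemma exists_state_energy_le (h : net.Standing) (hξ : ξ.IsModel μ) (hK : net.IsControlRiccati K)
    (hS : net.IsFilterRiccati S) : ∃ c : ℝ, ∀ k,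
      ∫ ω, (net.loop μ ξ K S k ω).1 ⬝ᵥ (K *ᵥ (net.loop μ ξ K S k ω).1) ∂μ ≤ c := by
  have hw : ∀ k, SquareIntegrable μ (ξ.w k) := fun k => hξ.squareIntegrable (.proc k)
  have he := fun k => estError_squareIntegrable (S := S) h hξ hK k
  have hg := ((feedforward_squareIntegrable h hξ hK).mulVec (net.M K)).mulVec net.bigB
  set T : Matrix net.X net.X ℝ := -(net.bigB * net.L K)
  obtain ⟨c, hc⟩ := (trace_mul_errCov_tendsto h hξ hK hS (Tᵀ * K * T)).bddAbove_range
  have hTe : ∀ k, ∫ ω, (T *ᵥ net.estError μ ξ K S k ω) ⬝ᵥ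
      (K *ᵥ (T *ᵥ net.estError μ ξ K S k ω)) ∂μ ≤ c := fun k => by
    have e : ∀ ω, (T *ᵥ net.estError μ ξ K S k ω) ⬝ᵥ (K *ᵥ (T *ᵥ net.estError μ ξ K S k ω))
        = net.estError μ ξ K S k ω ⬝ᵥ ((Tᵀ * K * T) *ᵥ net.estError μ ξ K S k ω) := fun ω => by
      rw [mulVec_dotProduct_eq]
      simp only [mulVec_mulVec, Matrix.mul_assoc]
    simp only [e]
    rw [integral_quad (he k) _ (he k)]
    exact hc ⟨k, rfl⟩
  refine exists_integral_quad_le_of_lyapunov hK.1 (stage_weight_posDef h K) (hK.lyapunov h)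
    (fun k => state_squareIntegrable h hξ hK k) (fun k => hg.add ((hw k).add ((he k).mulVec T)))
    (fun k ω => loop_succ_fst_closedLoop k ω)
    -- The disturbance has three parts: feedforward, process noise and estimation error. The
    -- constant comes from splitting them by `integral_quad_add_le` twice with t = 1.
    (c := (1 + 1) * (∫ ω, (net.bigB *ᵥ (net.M K *ᵥ net.feedforward ξ K ω)) ⬝ᵥ
        (K *ᵥ (net.bigB *ᵥ (net.M K *ᵥ net.feedforward ξ K ω))) ∂μ)
      + (1 + 1⁻¹) * ((1 + 1) * (K * net.bigW).trace + (1 + 1⁻¹) * c)) (fun k => ?_)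
  have h1 := integral_quad_add_le hK.1 hg ((hw k).add ((he k).mulVec T)) one_pos
  have h2 := integral_quad_add_le hK.1 (hw k) ((he k).mulVec T) one_pos
  rw [integral_quad (hw k) K (hw k), hξ.crossMoment_proc h] at h2
  have h3 := h2.trans (add_le_add_right (mul_le_mul_of_nonneg_left (hTe k) (by norm_num)) _)
  exact h1.trans (add_le_add_right (mul_le_mul_of_nonneg_left h3 (by norm_num)) _)

lemma exists_abs_integral_valueAlong_le (h : net.Standing) (hξ : ξ.IsModel μ)
    (hK : net.IsControlRiccati K) (hS : net.IsFilterRiccati S) :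
    ∃ c : ℝ, ∀ k, |∫ ω, net.valueAlong μ ξ K S k ω ∂μ| ≤ c := by
  obtain ⟨c, hc⟩ := exists_state_energy_le h hξ hK hS
  obtain ⟨p, hp, hpz⟩ := exists_le_quad (hK.posDef h)
  have hg := feedforward_squareIntegrable h hξ hK
  refine ⟨(1 + p⁻¹) * c + ∫ ω, net.feedforward ξ K ω ⬝ᵥ net.feedforward ξ K ω ∂μ, fun k => ?_⟩
  have hx := state_squareIntegrable (S := S) h hξ hK k
  have i1 := (hx.integrable_quad K hx).const_mul (1 + p⁻¹)
  have i2 := hg.integrable_dotProduct hg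
  -- 2|g·x| ≤ |g|² + |x|², and |x|² ≤ p⁻¹ xᵀKx because K ⪰ p I.
  have hpt : ∀ ω, |net.valueAlong μ ξ K S k ω| ≤
      (1 + p⁻¹) * ((net.loop μ ξ K S k ω).1 ⬝ᵥ (K *ᵥ (net.loop μ ξ K S k ω).1))
        + net.feedforward ξ K ω ⬝ᵥ net.feedforward ξ K ω := fun ω => by
    unfold valueAlong
    generalize (net.loop μ ξ K S k ω).1 = x
    generalize net.feedforward ξ K ω = g
    have h1 : 0 ≤ x ⬝ᵥ (K *ᵥ x) := hK.1.dotProduct_mulVec_nonneg x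
    have h2 : x ⬝ᵥ x ≤ p⁻¹ * (x ⬝ᵥ (K *ᵥ x)) := by
      rw [le_inv_mul_iff₀ hp]
      exact hpz x
    have h3 : 0 ≤ (g + x) ⬝ᵥ (g + x) := dotProduct_self_star_nonneg (g + x)
    have h4 : 0 ≤ (g - x) ⬝ᵥ (g - x) := dotProduct_self_star_nonneg (g - x)
    simp only [add_dotProduct, dotProduct_add, sub_dotProduct, dotProduct_sub,
      dotProduct_comm x g] at h3 h4
    rw [abs_le]
    constructor <;> linarith
  calc |∫ ω, net.valueAlong μ ξ K S k ω ∂μ|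
      ≤ ∫ ω, |net.valueAlong μ ξ K S k ω| ∂μ := abs_integral_le_integral_abs
    _ ≤ _ := integral_mono (valueAlong_integrable h hξ hK k).abs (i1.add i2) hpt
    _ = (1 + p⁻¹) * ∫ ω, (net.loop μ ξ K S k ω).1 ⬝ᵥ (K *ᵥ (net.loop μ ξ K S k ω).1) ∂μ
        + ∫ ω, net.feedforward ξ K ω ⬝ᵥ net.feedforward ξ K ω ∂μ := by
        rw [← integral_const_mul]
        exact integral_add i1 i2
    _ ≤ _ := by
        have := mul_le_mul_of_nonneg_left (hc k) (show 0 ≤ 1 + p⁻¹ by positivity)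
        linarith

/-- The private cost exists, with an explicit value. -/
lemma isPrivateCost (h : net.Standing) (hξ : ξ.IsModel μ)
    (hK : net.IsControlRiccati K) (hS : net.IsFilterRiccati S) :
    net.IsPrivateCost μ ξ K S ((K * net.bigW).trace + (∫ ω, net.refTerm ξ K ω ∂μ)
      + (net.errorWeight K * net.postCov S).trace) := by
  refine ⟨fun k => stageCost_integrable h hξ hK k, ?_⟩
  obtain ⟨c, hc⟩ := exists_abs_integral_valueAlong_le h hξ hK hS
  have h1 := tendsto_average_of_telescope (fun k => integral_stageCost (S := S) h hξ hK k) hc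
    (trace_mul_errCov_tendsto h hξ hK hS (net.errorWeight K))
  refine h1.congr fun n => ?_
  rw [integral_finsetSum _ fun k _ => stageCost_integrable h hξ hK k]

end Cost

/-! ### Bounding the cost through the noise levels -/

section Bound

/-- In σ² ≤ Δ²η₅² the sensitivity cancels against the one inside η₅, leaving a bound common to all
agents. -/
lemma σ_le_of_privacy (h : net.Standing)
    {α : ℝ} {l : net.X} {i : Fin N}
    (hδ : net.δ i ∈ Set.Icc ((10 : ℝ) ^ (-5 : ℤ)) ((10 : ℝ) ^ (-1 : ℤ)))
    {D : ℝ} (hD : D = lambdaMax K * ((net.bigAᵀ * net.bigA).trace / net.bigC l l ^ 2)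
        + ((net.H K)ᵀ * net.R * net.H K).trace + net.Q.trace) (hDpos : 0 < D)
    (hα : 0 < net.costMargin K α)
    (hε : net.ε i ≥ 1 / 8 * ((1 + √(36 * net.eta5 K α l i + 1)) / net.eta5 K α l i) ^ 2) :
    net.σ i ^ 2 * D ≤ net.costMargin K α := by
  have hs := h.sens_pos i
  have hη : 0 < net.eta5 K α l i := by
    rw [eta5, ← hD]
    exact Real.sqrt_pos.mpr (by positivity)
  have h1 : net.σ i ≤ net.sens i * net.eta5 K α l i :=
    gaussianMechanismStd_le hs.le (h.ε_pos i) hη hδ hε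
  have h2 : net.eta5 K α l i ^ 2 = net.costMargin K α / (net.sens i ^ 2 * D) := by
    rw [eta5, ← hD]
    exact Real.sq_sqrt (by positivity)
  calc net.σ i ^ 2 * D ≤ (net.sens i * net.eta5 K α l i) ^ 2 * D :=
        mul_le_mul_of_nonneg_right (pow_le_pow_left₀ (h.σ_pos i).le h1 2) hDpos.le
    _ = net.costMargin K α := by
        rw [mul_pow, h2]
        field_simp

/-- Since C and V are diagonal, V ⪯ s CCᵀ means σ_j²/C_j² ≤ s for all j, and the choice of l makes s
= σ_l²/C_l² admissible. -/
lemma postCov_le (h : net.Standing) (hS : net.IsFilterRiccati S) {l : net.X}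
    (hl : net.IsMinSignalToNoise l) :
    ((net.σ l.1 ^ 2 / net.bigC l l ^ 2) • (1 : Matrix net.X net.X ℝ)
      - net.postCov S).PosSemidef := by
  refine updated_cov_le h.V_posDef hS.1 rfl h.C_posDef.det_pos.ne'.isUnit ?_
  have hd : net.bigC = diagonal fun p => net.bigC p p := (h.C_diag.diagonal_diag).symm
  have e : (net.σ l.1 ^ 2 / net.bigC l l ^ 2) • (net.bigC * net.bigCᵀ) - net.V
      = diagonal fun p => (net.σ l.1 ^ 2 / net.bigC l l ^ 2) * (net.bigC p p * net.bigC p p)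
        - net.σ p.1 ^ 2 := by
    generalize net.σ l.1 ^ 2 / net.bigC l l ^ 2 = s
    rw [hd, diagonal_transpose, diagonal_mul_diagonal, ← diagonal_smul, V, diagonal_sub]
    simp
  rw [e, posSemidef_diagonal_iff]
  intro p
  have h1 := hl p
  have hcl := h.bigC_apply_pos l
  have hσl := h.σ_pos l.1
  have hσp := h.σ_pos p.1
  rw [div_le_div_iff₀ (by positivity) (by positivity)] at h1
  rw [sub_nonneg, div_mul_eq_mul_div, le_div_iff₀ (by positivity)]
  linarith

/-- The weight is AᵀKA − (K − Q); the subtracted part has nonnegative trace against Σ̄. Then Σ̄ and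
K are replaced by their scalar upper bounds. -/
lemma trace_errorWeight_mul_postCov_le (h : net.Standing) (hK : net.IsControlRiccati K)
    (hS : net.IsFilterRiccati S) {l : net.X} (hl : net.IsMinSignalToNoise l) :
    (net.errorWeight K * net.postCov S).trace ≤
      net.σ l.1 ^ 2 * (lambdaMax K * ((net.bigAᵀ * net.bigA).trace / net.bigC l l ^ 2)) := by
  have hs0 : 0 ≤ net.σ l.1 ^ 2 / net.bigC l l ^ 2 := by positivity
  have h1 := trace_mul_nonneg (hK.sub_posDef h) (hS.postCov_posSemidef h)
  have hAKA := hK.1.conjTranspose_mul_mul_same net.bigA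
  have hAA := posSemidef_self_mul_conjTranspose net.bigA
  rw [conjTranspose_eq_transpose_of_trivial] at hAKA hAA
  have h2 := trace_mul_le (postCov_le h hS hl) hAKA
  have h3 := trace_mul_le (posSemidef_lambdaMax_sub hK.1.isHermitian) hAA
  rw [trace_mul_comm] at h2
  have h4 : (net.bigAᵀ * K * net.bigA).trace ≤ lambdaMax K * (net.bigAᵀ * net.bigA).trace := by
    rw [trace_mul_comm net.bigAᵀ, Matrix.mul_assoc, trace_mul_comm, Matrix.mul_assoc]
    exact h3
  rw [errorWeight_eq h hK, Matrix.sub_mul, Matrix.add_mul, trace_sub, trace_add]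
  rw [Matrix.sub_mul, trace_sub] at h1
  have h5 := mul_le_mul_of_nonneg_left h4 hs0
  calc _ ≤ _ := by linarith
    _ ≤ _ := h2.trans h5
    _ = _ := by ring

end Bound

end Network

end PrivateLQG

end

theorem mainTheorem11 {N : ℕ} (net : PrivateLQG.Network N) (hnet : net.Standing)
    (hδ : ∀ i, net.δ i ∈ Set.Icc ((10 : ℝ) ^ (-5 : ℤ)) ((10 : ℝ) ^ (-1 : ℤ)))
    {Ω : Type*} [MeasurableSpace Ω] (μ : MeasureTheory.Measure Ω)
    [MeasureTheory.IsProbabilityMeasure μ] (ξ : net.Noise Ω) (hξ : ξ.IsModel μ)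
    (K S : Matrix net.X net.X ℝ) (hK : net.IsControlRiccati K) (hS : net.IsFilterRiccati S)
    (l : net.X) (hl : net.IsMinSignalToNoise l)
    (α : ℝ) (hα : 0 < net.costMargin K α)
    (hε : ∀ i, net.ε i ≥ 1 / 8 *
      ((1 + √(36 * net.eta5 K α l i + 1)) / net.eta5 K α l i) ^ 2) :
    ∃ J : ℝ, net.IsPrivateCost μ ξ K S J ∧ J ≤ α := by
  refine ⟨_, PrivateLQG.Network.isPrivateCost hnet hξ hK hS, ?_⟩
  have hlam := PrivateLQG.lambdaMax_nonneg hK.1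
  have hAA := (Matrix.posSemidef_conjTranspose_mul_self net.bigA).trace_nonneg
  have hH := (hnet.R_posDef.posSemidef.conjTranspose_mul_mul_same (net.H K)).trace_nonneg
  rw [Matrix.conjTranspose_eq_transpose_of_trivial] at hAA hH
  have hQpos : 0 < net.Q.trace :=
    Finset.sum_pos (fun p _ => hnet.Q_posDef.diag_pos) ⟨l, Finset.mem_univ l⟩
  have hA : 0 ≤ PrivateLQG.lambdaMax K *
      ((net.bigA.transpose * net.bigA).trace / net.bigC l l ^ 2) := by positivity
  obtain ⟨D, hD⟩ : ∃ D, D = PrivateLQG.lambdaMax K *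
      ((net.bigA.transpose * net.bigA).trace / net.bigC l l ^ 2)
      + ((net.H K).transpose * net.R * net.H K).trace + net.Q.trace := ⟨_, rfl⟩
  have hDpos : 0 < D := by rw [hD]; positivity
  have hσ : ∀ i, net.σ i ^ 2 * D ≤ net.costMargin K α := fun i =>
    PrivateLQG.Network.σ_le_of_privacy hnet (hδ i) hD hDpos hα (hε i)
  have hσ' : ∀ i, net.σ i ^ 2 ≤ net.costMargin K α / D := fun i =>
    (le_div_iff₀ hDpos).mpr (hσ i)
  have hm : 0 ≤ net.costMargin K α / D := by positivity
  have herr := (PrivateLQG.Network.trace_errorWeight_mul_postCov_le hnet hK hS hl).trans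
    (mul_le_mul_of_nonneg_right (hσ' l.1) hA)
  have hQW : (net.Q * net.Wbar).trace ≤ net.costMargin K α / D * net.Q.trace := by
    rw [PrivateLQG.Network.Wbar, Matrix.trace, Matrix.trace, Finset.mul_sum]
    refine Finset.sum_le_sum fun p _ => ?_
    rw [Matrix.diag_apply, Matrix.mul_diagonal, mul_comm]
    exact mul_le_mul_of_nonneg_right (hσ' p.1) hnet.Q_posDef.posSemidef.diag_nonneg
  have hKW := PrivateLQG.trace_mul_le
    (PrivateLQG.posSemidef_lambdaMax_sub hK.1.isHermitian) hnet.bigW_posDef.posSemidef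
  have href := PrivateLQG.Network.integral_refTerm_le hnet hξ hK
  -- The summand tr(HᵀRH) of D is nonnegative and here only provides slack.
  have hmD : net.costMargin K α / D * (PrivateLQG.lambdaMax K *
      ((net.bigA.transpose * net.bigA).trace / net.bigC l l ^ 2))
      + net.costMargin K α / D * net.Q.trace ≤ net.costMargin K α := by
    have h1 : net.costMargin K α / D * D = net.costMargin K α := div_mul_cancel₀ _ hDpos.ne'
    have h2 := mul_nonneg hm hH
    rw [hD] at h1 h2 ⊢
    linarith
  have hmargin : net.costMargin K α = α - PrivateLQG.lambdaMax K * net.bigW.trace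
      - dotProduct net.xbar (net.Q.mulVec net.xbar)
      + dotProduct (net.g K net.xbar)
        ((net.bigB * (net.inputWeight K)⁻¹ * net.bigB.transpose).mulVec (net.g K net.xbar)) := rfl
  linarith
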